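/- All systems $A,B,A',B',C,C'$ are finite-dimensional and of dimension at least $1$; $|X|$ denotes the dimension of the system $X$. A quantum channel is a completely positive, trace-preserving linear map. For $k\ge 1$, a bipartite channel $\mathcal N_{AB\to A'B'}$ is called $k$-extendible if there is a quantum channel $\mathcal M_{AB_1\cdots B_k\to A'B_1'\cdots B_k'}$ (each $B_i\simeq B$, $B_i'\simeq B'$) such that for all states $\theta_{AB_1\cdots B_k}$: (i) $\mathcal M(\mathcal W^\pi_{B_1\cdots B_k}(\theta))=\mathcal W^\pi_{B_1'\cdots B_k'}(\mathcal M(\theta))$ for every $\pi\in S_k$, where $\mathcal W^\pi$ is the unitary channel permuting the $k$ systems; (ii) $\mathcal N(\theta_{AB_1})=\operatorname{Tr}_{B_2'\cdots B_k'}\{\mathcal M(\theta)\}$. A channel $\mathcal A_{C\to C'}$ from Alice to Bob is called $k$-extendible if it is so as a bipartite channel in which Alice's input is $C$, Bob's output is $C'$, and Bob's input and Alice's output are trivial. A one-way LOCC (1W-LOCC) channel from $AB$ to $A'B'$ is a map $\sum_y \mathcal E^y_{A\to A'}\otimes\mathcal F^y_{B\to B'}$ (finite sum), where the $\mathcal E^y$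 are completely positive, $\sum_y\mathcal E^y$ is trace preserving and every $\mathcal F^y$ is a quantum channel. The diamond norm of a difference of two channels with input system $S$ is $\|\mathcal N-\mathcal M\|_\diamond=\max_{\psi_{RS}}\|(\operatorname{id}_R\otimes(\mathcal N-\mathcal M))(\psi_{RS})\|_1$, the maximum being over pure states $\psi_{RS}$ with $R\simeq S$. Proposition. Let $k\ge1$, let $\mathcal E_{A\to A'C}$ and $\mathcal D_{C'B\to B'}$ be quantum channels, let $\mathcal A^k_{C\to C'}$ be a $k$-extendible channel, and let $\mathcal K^k_{AB\to A'B'}=\mathcal D_{C'B\to B'}\circ\mathcal A^k_{C\to C'}\circ\mathcal E_{A\to A'C}$. Then the minimum below is attained and $$\min_{\mathcal L\in \text{1W-LOCC}(AB\to A'B')}\left\|\mathcal K^k-\mathcal L\right\|_\diamond\le |C|\,\frac{2|C'|^2}{|C'|^2+k}.$$ In particular, if $|C'|\le|C|$ (for instance if $C'\simeq C$), then the minimum is at most $|C|\,\frac{2|C|^2}{|C|^2+k}$. Consequently, for fixed systems $A,B,A',B',C,C'$, the channels $\mathcal K^k$ converge to the set of 1W-LOCC channels as $k\to\infty$, uniformly: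 for every $\varepsilon>0$ there is $k_0$ such that for all $k\ge k_0$ every channel $\mathcal K^k$ of the above form is within diamond distance less than $\varepsilon$ of some 1W-LOCC channel. -/

import Mathlib

/-!
Finite-dimensional quantum systems are modelled by finite index types: the system `A` has Hilbert
space `ℂ^A` of dimension `Fintype.card A`, operators on it are matrices `Matrix A A ℂ`, and the
composite system `AB` has index type `A × B`.
-/

open scoped ComplexOrder

/-- Linear maps from operators on the system `A` to operators on the system `B`. -/
abbrev Superop (A B : Type*) := Matrix A A ℂ →ₗ[ℂ] Matrix B B ℂ

/-- `id_R ⊗ Φ`. -/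
def idTensor {A B : Type*} (R : Type*) (Φ : Superop A B) : Superop (R × A) (R × B) where
  toFun X := Matrix.of fun p q => Φ (Matrix.of fun a a' => X (p.1, a) (q.1, a')) p.2 q.2
  map_add' X Y := by
    ext p q
    exact congrFun (congrFun (map_add Φ (Matrix.of fun a a' => X (p.1, a) (q.1, a'))
      (Matrix.of fun a a' => Y (p.1, a) (q.1, a'))) p.2) q.2
  map_smul' c X := by
    ext p q
    exact congrFun (congrFun (map_smul Φ c (Matrix.of fun a a' => X (p.1, a) (q.1, a'))) p.2) q.2

/-- `Φ ⊗ id_R`. -/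
def tensorId {A B : Type*} (Φ : Superop A B) (R : Type*) : Superop (A × R) (B × R) where
  toFun X := Matrix.of fun p q => Φ (Matrix.of fun a a' => X (a, p.2) (a', q.2)) p.1 q.1
  map_add' X Y := by
    ext p q
    exact congrFun (congrFun (map_add Φ (Matrix.of fun a a' => X (a, p.2) (a', q.2))
      (Matrix.of fun a a' => Y (a, p.2) (a', q.2))) p.1) q.1
  map_smul' c X := by
    ext p q
    exact congrFun (congrFun (map_smul Φ c (Matrix.of fun a a' => X (a, p.2) (a', q.2))) p.1) q.1

/-- `Φ ⊗ Ψ = (Φ ⊗ id) ∘ (id ⊗ Ψ)`. -/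
def tensorMap {A A' B B' : Type*} (Φ : Superop A A') (Ψ : Superop B B') :
    Superop (A × B) (A' × B') :=
  tensorId Φ B' ∘ₗ idTensor A Ψ

/-- Relabelling of a system along a bijection of the index types. -/
def relabel {A B : Type*} (e : A ≃ B) : Superop A B :=
  (Matrix.reindexLinearEquiv ℂ ℂ e e).toLinearMap

/-- Complete positivity: `id_R ⊗ Φ` preserves positive semidefiniteness for every
finite-dimensional reference system `R`. -/
def IsCompletelyPositive {A B : Type*} (Φ : Superop A B) : Prop :=
  ∀ (n : ℕ) (X : Matrix (Fin n × A) (Fin n × A) ℂ),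
    X.PosSemidef → (idTensor (Fin n) Φ X).PosSemidef

/-- A quantum channel: a completely positive and trace-preserving map. -/
structure IsQuantumChannel {A B : Type*} [Fintype A] [Fintype B] (Φ : Superop A B) : Prop where
  completelyPositive : IsCompletelyPositive Φ
  trace_eq : ∀ X : Matrix A A ℂ, (Φ X).trace = X.trace

/-- Density operators. -/
structure IsDensityOperator {A : Type*} [Fintype A] (ρ : Matrix A A ℂ) : Prop where
  posSemidef : ρ.PosSemidef
  trace_eq_one : ρ.trace = 1

/-! ### Trace norm and diamond norm -/

/-- The trace norm `‖X‖₁ = Tr √(X† X)`: the sum of the singular values of `X`. -/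
noncomputable def traceNorm {A : Type*} [Fintype A] [DecidableEq A] (X : Matrix A A ℂ) : ℝ :=
  ∑ i, √((Matrix.isHermitian_conjTranspose_mul_self X).eigenvalues i)

/-- The diamond norm: the maximum of `‖(id_R ⊗ Φ)(ψ_{RA})‖₁` over the pure states
`ψ_{RA} = |ψ⟩⟨ψ|`, where `R` is a reference system isomorphic to the input system `A`. -/
noncomputable def diamondNorm {A B : Type*} [Fintype A] [DecidableEq A] [Fintype B] [DecidableEq B]
    (Φ : Superop A B) : ℝ :=
  sSup {r : ℝ | ∃ ψ : A × A → ℂ, ∑ p, ‖ψ p‖ ^ 2 = 1 ∧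
    r = traceNorm (idTensor A Φ (Matrix.vecMulVec ψ (star ψ)))}

/-! ### One-way LOCC channels -/

/-- One-way LOCC channels from Alice (`A → A'`) to Bob (`B → B'`): the maps `∑_y ℰ^y ⊗ ℱ^y`, where
`y` ranges over a finite set, the `ℰ^y` are completely positive maps whose sum is trace preserving
(a quantum instrument) and the `ℱ^y` are quantum channels. -/
def oneWayLOCC (A B A' B' : Type*) [Fintype A] [Fintype B] [Fintype A'] [Fintype B'] :
    Set (Superop (A × B) (A' × B')) :=
  {L | ∃ (n : ℕ) (ℰ : Fin n → Superop A A') (ℱ : Fin n → Superop B B'),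
    (∀ y, IsCompletelyPositive (ℰ y)) ∧
    (∀ X : Matrix A A ℂ, ((∑ y, ℰ y) X).trace = X.trace) ∧
    (∀ y, IsQuantumChannel (ℱ y)) ∧
    L = ∑ y, tensorMap (ℰ y) (ℱ y)}

/-! ### `k`-extendible channels -/

/-- The permutation channel `𝒲^π_{B_1⋯B_k}` acting on operators on `A B_1 ⋯ B_k`. -/
def permuteB {A B : Type*} {k : ℕ} (π : Equiv.Perm (Fin k))
    (X : Matrix (A × (Fin k → B)) (A × (Fin k → B)) ℂ) :
    Matrix (A × (Fin k → B)) (A × (Fin k → B)) ℂ :=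
  Matrix.of fun p q => X (p.1, p.2 ∘ π) (q.1, q.2 ∘ π)

/-- The partial trace over all the systems `B_j` with `j ≠ i` of an operator on `A B_1 ⋯ B_k`. -/
def keepOneB {A B : Type*} [Fintype B] [DecidableEq B] {k : ℕ} (i : Fin k)
    (X : Matrix (A × (Fin k → B)) (A × (Fin k → B)) ℂ) : Matrix (A × B) (A × B) ℂ :=
  Matrix.of fun p q =>
    ∑ f : Fin k → B, if f i = p.2 then X (p.1, f) (q.1, Function.update f i q.2) else 0

/-- A bipartite channel `N_{AB → A'B'}` is `k`-extendible (`k ≥ 1`) if there is a channel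
`M_{AB_1⋯B_k → A'B'_1⋯B'_k}` which is covariant with respect to permutations of the `B` systems
and has `N` as its marginal. The system `B_1` has index `0 : Fin k`. -/
def IsKExtendible {A B A' B' : Type*} [Fintype A] [Fintype B] [DecidableEq B] [Fintype A']
    [Fintype B'] [DecidableEq B'] (k : ℕ) (N : Superop (A × B) (A' × B')) : Prop :=
  IsQuantumChannel N ∧
  ∃ (hk : 0 < k) (M : Superop (A × (Fin k → B)) (A' × (Fin k → B'))),
    IsQuantumChannel M ∧
    (∀ (π : Equiv.Perm (Fin k)) (θ : Matrix (A × (Fin k → B)) (A × (Fin k → B)) ℂ),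
      IsDensityOperator θ → M (permuteB π θ) = permuteB π (M θ)) ∧
    (∀ θ : Matrix (A × (Fin k → B)) (A × (Fin k → B)) ℂ,
      IsDensityOperator θ → N (keepOneB ⟨0, hk⟩ θ) = keepOneB ⟨0, hk⟩ (M θ))

/-- A map `C → C'` from Alice to Bob, regarded as a bipartite map in which Alice's output system
and Bob's input system are trivial (one-dimensional). -/
def asBipartite {C C' : Type*} (Φ : Superop C C') : Superop (C × Unit) (Unit × C') :=
  relabel (Equiv.punitProd C').symm ∘ₗ Φ ∘ₗ relabel (Equiv.prodPUnit C)

/-- A channel `C → C'` from Alice to Bob that is `k`-extendible. -/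
def IsKExtendibleMessage {C C' : Type*} [Fintype C] [Fintype C'] [DecidableEq C'] (k : ℕ)
    (Φ : Superop C C') : Prop :=
  IsKExtendible k (asBipartite Φ)

/-- The map `𝒟_{C'B → B'} ∘ 𝒜_{C → C'} ∘ ℰ_{A → A'C}`, from `AB` to `A'B'`: Alice applies `ℰ`, her
message `C` passes through `𝒜`, and Bob applies `𝒟`. -/
def messageProtocol {A B A' B' C C' : Type*} (ℰ : Superop A (A' × C)) (𝒜 : Superop C C')
    (𝒟 : Superop (C' × B) B') : Superop (A × B) (A' × B') :=
  idTensor A' 𝒟 ∘ₗ relabel (Equiv.prodAssoc A' C' B) ∘ₗ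
    tensorId (idTensor A' 𝒜) B ∘ₗ tensorId ℰ B

/-! The `k`-extendible channel `𝒜` becomes measure-and-prepare after mixing with a little white
noise. With `d = |C'|` and `Δ` the completely depolarizing channel, `k 𝒜 + d² Δ` is a finite sum of
maps `X ↦ Tr(Pᵀ X) Q` with `P ≥ 0` and `Q` a state
(`IsKExtendibleMessage.exists_sum_measurePrepare`). Divided by `d² + k`, it is a channel `ℳ` with `𝒜
- ℳ = d²/(d² + k) (𝒜 - Δ)`. Placed between `ℰ` and `𝒟`, `ℳ` is a measurement by Alice whose outcome
tells Bob what to prepare, hence a one-way LOCC channel. Two channels are at diamond distance at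
most `2`, so the error is at most `2d²/(d² + k)`; the factor `|C| ≥ 1` in the statement is slack.

The decomposition is an exact finite de Finetti identity. The Choi matrix `σ` of the extension is
permutation invariant, and so is its purification by `√σ`, a symmetric tensor over `C' × C'`. For a
Gaussian vector `z`, contract this tensor with `z^{⊗k}` and prepare the reduced operator of
`|z⟩⟨z|`. By Wick's formula (`integral_complexGaussianPi`) the mean of these product operators is
`k!` times the sum of two terms: `k` times the one-copy marginal of `σ`, and `d` times the identity
on `C'` tensored with the `C`-marginal (`exists_separable_decomposition_of_symmetric`). The mean
lies in the closed convex cone of separable operators, so it is a finite sum of products.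

The minimum is attained because, by Carathéodory's theorem, the Choi matrices of one-way LOCC
channels form a compact set (`isCompact_choi_image_oneWayLOCC`), on which the diamond distance is
lower semicontinuous. -/

/-! ### Choi matrices, complete positivity and measure-and-prepare maps. -/

section Superoperators

variable {A B C D R : Type*}

theorem superop_apply_eq_sum [Fintype A] [DecidableEq A] (Φ : Superop A B) (X : Matrix A A ℂ) :
    Φ X = ∑ a, ∑ a', X a a' • Φ (Matrix.single a a' 1) := by
  conv_lhs => rw [Matrix.matrix_eq_sum_single X]
  simp only [map_sum, ← map_smul, Matrix.smul_single, smul_eq_mul, mul_one]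

theorem superop_apply_apply_eq_sum [Fintype A] [DecidableEq A] (Φ : Superop A B)
    (X : Matrix A A ℂ) (b b' : B) :
    Φ X b b' = ∑ a, ∑ a', X a a' * Φ (Matrix.single a a' 1) b b' := by
  rw [superop_apply_eq_sum Φ X]
  simp [Matrix.sum_apply]

/-- The Choi matrix of a superoperator. -/
def choi [DecidableEq A] (Φ : Superop A B) : Matrix (A × B) (A × B) ℂ :=
  Matrix.of fun p q => Φ (Matrix.single p.1 q.1 1) p.2 q.2

/-- The superoperator with a given Choi matrix. -/
def ofChoi [Fintype A] (G : Matrix (A × B) (A × B) ℂ) : Superop A B where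
  toFun X := Matrix.of fun b b' => ∑ a, ∑ a', X a a' * G (a, b) (a', b')
  map_add' X Y := by
    ext b b'
    simp [add_mul, Finset.sum_add_distrib]
  map_smul' c X := by
    ext b b'
    simp [Finset.mul_sum, mul_assoc]

theorem ofChoi_apply [Fintype A] (G : Matrix (A × B) (A × B) ℂ) (X : Matrix A A ℂ) (b b' : B) :
    ofChoi G X b b' = ∑ a, ∑ a', X a a' * G (a, b) (a', b') := rfl

theorem ofChoi_choi [Fintype A] [DecidableEq A] (Φ : Superop A B) : ofChoi (choi Φ) = Φ := by
  refine LinearMap.ext fun X => ?_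
  ext b b'
  rw [ofChoi_apply, superop_apply_apply_eq_sum]
  rfl

theorem choi_ofChoi [Fintype A] [DecidableEq A] (G : Matrix (A × B) (A × B) ℂ) :
    choi (ofChoi G) = G := by
  ext ⟨a, b⟩ ⟨a', b'⟩
  simp only [choi, Matrix.of_apply, ofChoi_apply, Matrix.single_apply]
  rw [Finset.sum_eq_single a (fun x _ hx => by simp [hx.symm]) (by simp),
    Finset.sum_eq_single a' (fun x _ hx => by simp [hx.symm]) (by simp)]
  simp

theorem idTensor_apply (Φ : Superop A B) (X : Matrix (R × A) (R × A) ℂ) (p q : R × B) :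
    idTensor R Φ X p q = Φ (Matrix.of fun a a' => X (p.1, a) (q.1, a')) p.2 q.2 := rfl

theorem tensorId_apply (Φ : Superop A B) (X : Matrix (A × R) (A × R) ℂ) (p q : B × R) :
    tensorId Φ R X p q = Φ (Matrix.of fun a a' => X (a, p.2) (a', q.2)) p.1 q.1 := rfl

theorem relabel_apply (e : A ≃ B) (X : Matrix A A ℂ) (b b' : B) :
    relabel e X b b' = X (e.symm b) (e.symm b') := rfl

theorem IsCompletelyPositive.posSemidef_idTensor [Fintype R] {Φ : Superop A B}
    (hΦ : IsCompletelyPositive Φ) {X : Matrix (R × A) (R × A) ℂ} (hX : X.PosSemidef) :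
    (idTensor R Φ X).PosSemidef := by
  let e := Fintype.equivFin R
  have h := (hΦ _ _ (hX.submatrix (Prod.map e.symm id))).submatrix (Prod.map e id)
  convert h using 1
  ext p q
  simp [idTensor_apply]

theorem IsCompletelyPositive.posSemidef {Φ : Superop A B}
    (hΦ : IsCompletelyPositive Φ) {X : Matrix A A ℂ} (hX : X.PosSemidef) :
    (Φ X).PosSemidef :=
  (hΦ.posSemidef_idTensor (R := Unit) (hX.submatrix Prod.snd)).submatrix fun b => ((), b)

theorem IsCompletelyPositive.comp {Φ : Superop A B} {Ψ : Superop B C}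
    (hΨ : IsCompletelyPositive Ψ) (hΦ : IsCompletelyPositive Φ) :
    IsCompletelyPositive (Ψ ∘ₗ Φ) :=
  fun n X hX => hΨ n _ (hΦ n X hX)

theorem IsCompletelyPositive.idTensor [Fintype R] {Φ : Superop A B}
    (hΦ : IsCompletelyPositive Φ) : IsCompletelyPositive (idTensor R Φ) := fun n _ hX =>
  (hΦ.posSemidef_idTensor (hX.submatrix (Equiv.prodAssoc (Fin n) R A))).submatrix
    (Equiv.prodAssoc (Fin n) R B).symm

theorem IsCompletelyPositive.tensorId [Fintype R] {Φ : Superop A B}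
    (hΦ : IsCompletelyPositive Φ) : IsCompletelyPositive (tensorId Φ R) := fun n _ hX =>
  (hΦ.posSemidef_idTensor (R := Fin n × R)
    (hX.submatrix fun p : (Fin n × R) × A => (p.1.1, (p.2, p.1.2)))).submatrix
    fun p : Fin n × (B × R) => ((p.1, p.2.2), p.2.1)

theorem IsCompletelyPositive.relabel (e : A ≃ B) : IsCompletelyPositive (relabel e) :=
  fun _ _ hX => hX.submatrix (Prod.map id e.symm)

/-- The output is the compression `V† (X ⊗ G) V`, where `V` contracts the two copies of `A` with
each other. -/
theorem isCompletelyPositive_ofChoi [Fintype A] [Fintype B] {G : Matrix (A × B) (A × B) ℂ}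
    (hG : G.PosSemidef) : IsCompletelyPositive (ofChoi G) := by
  classical
  intro n X hX
  let V : Matrix ((Fin n × A) × (A × B)) (Fin n × B) ℂ :=
    Matrix.of fun p q => if p.1.1 = q.1 ∧ p.1.2 = p.2.1 ∧ p.2.2 = q.2 then 1 else 0
  suffices h : idTensor (Fin n) (ofChoi G) X =
      V.conjTranspose * Matrix.kroneckerMap (· * ·) X G * V by
    rw [h]
    exact (hX.kronecker hG).conjTranspose_mul_mul_same V
  ext ⟨i, b⟩ ⟨j, b'⟩
  simp only [idTensor_apply, ofChoi_apply, Matrix.of_apply, Matrix.mul_apply,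
    Matrix.conjTranspose_apply, Matrix.kroneckerMap_apply, V, Fintype.sum_prod_type]
  simp only [ite_and, apply_ite star, star_one, star_zero, ite_mul, zero_mul, one_mul, mul_ite,
    mul_zero, mul_one, Finset.sum_ite_eq, Finset.sum_ite_eq', Finset.mem_univ, if_true,
    Finset.sum_ite_irrel, Finset.sum_const_zero]
  rw [Finset.sum_comm]

/-- The Choi matrix is the image of the unnormalized maximally entangled state. -/
theorem IsCompletelyPositive.posSemidef_choi [Fintype A] [DecidableEq A] {Φ : Superop A B}
    (hΦ : IsCompletelyPositive Φ) : (choi Φ).PosSemidef := by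
  let v : A × A → ℂ := fun p => if p.1 = p.2 then 1 else 0
  suffices h : choi Φ = _root_.idTensor A Φ (Matrix.vecMulVec v (star v)) by
    rw [h]
    exact hΦ.posSemidef_idTensor (Matrix.posSemidef_vecMulVec_self_star v)
  ext p q
  simp only [choi, idTensor_apply, Matrix.of_apply]
  refine congrFun (congrFun (congrArg Φ ?_) p.2) q.2
  ext a a'
  by_cases h₁ : p.1 = a <;> by_cases h₂ : q.1 = a' <;>
    simp [Matrix.vecMulVec_apply, v, h₁, h₂]

theorem isCompletelyPositive_sum {ι : Type*} (s : Finset ι) {Φ : ι → Superop A B}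
    (hΦ : ∀ i ∈ s, IsCompletelyPositive (Φ i)) : IsCompletelyPositive (∑ i ∈ s, Φ i) := by
  intro n X hX
  have : idTensor (Fin n) (∑ i ∈ s, Φ i) X = ∑ i ∈ s, idTensor (Fin n) (Φ i) X := by
    ext p q
    simp [idTensor_apply, Matrix.sum_apply]
  rw [this]
  exact Matrix.posSemidef_sum s fun i hi => hΦ i hi n X hX

/-- The map `X ↦ Tr(Pᵀ X) Q`. -/
def measurePrepare [Fintype A] (P : Matrix A A ℂ) (Q : Matrix B B ℂ) : Superop A B :=
  ofChoi (Matrix.kroneckerMap (· * ·) P Q)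

theorem measurePrepare_apply [Fintype A] (P : Matrix A A ℂ) (Q : Matrix B B ℂ)
    (X : Matrix A A ℂ) : measurePrepare P Q X = (∑ a, ∑ a', X a a' * P a a') • Q := by
  ext b b'
  simp [measurePrepare, ofChoi_apply, Finset.sum_mul, mul_assoc]

theorem isCompletelyPositive_measurePrepare [Fintype A] [Fintype B] {P : Matrix A A ℂ}
    {Q : Matrix B B ℂ} (hP : P.PosSemidef) (hQ : Q.PosSemidef) :
    IsCompletelyPositive (measurePrepare P Q) := by
  classical
  exact isCompletelyPositive_ofChoi (hP.kronecker hQ)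

section Channels

variable [Fintype A] [Fintype B]

theorem IsQuantumChannel.comp [Fintype C] {Φ : Superop A B} {Ψ : Superop B C}
    (hΨ : IsQuantumChannel Ψ) (hΦ : IsQuantumChannel Φ) : IsQuantumChannel (Ψ ∘ₗ Φ) :=
  ⟨hΨ.1.comp hΦ.1, fun X => (hΨ.2 _).trans (hΦ.2 X)⟩

theorem IsQuantumChannel.idTensor [Fintype R] {Φ : Superop A B} (hΦ : IsQuantumChannel Φ) :
    IsQuantumChannel (idTensor R Φ) := by
  refine ⟨hΦ.1.idTensor, fun X => ?_⟩
  simp only [Matrix.trace, Matrix.diag_apply, Fintype.sum_prod_type, idTensor_apply]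
  refine Finset.sum_congr rfl fun r _ => ?_
  exact hΦ.2 (Matrix.of fun a a' => X (r, a) (r, a'))

theorem IsQuantumChannel.tensorId [Fintype R] {Φ : Superop A B} (hΦ : IsQuantumChannel Φ) :
    IsQuantumChannel (tensorId Φ R) := by
  refine ⟨hΦ.1.tensorId, fun X => ?_⟩
  simp only [Matrix.trace, Matrix.diag_apply, Fintype.sum_prod_type_right, tensorId_apply]
  refine Finset.sum_congr rfl fun r _ => ?_
  exact hΦ.2 (Matrix.of fun a a' => X (a, r) (a', r))

theorem IsQuantumChannel.relabel (e : A ≃ B) : IsQuantumChannel (relabel e) :=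
  ⟨.relabel e, fun X => e.symm.sum_comp fun a => X a a⟩

theorem IsQuantumChannel.isDensityOperator {Φ : Superop A B} (hΦ : IsQuantumChannel Φ)
    {ρ : Matrix A A ℂ} (hρ : IsDensityOperator ρ) : IsDensityOperator (Φ ρ) :=
  ⟨hΦ.1.posSemidef hρ.1, (hΦ.2 ρ).trans hρ.2⟩

theorem isQuantumChannel_measurePrepare_one [DecidableEq A] {Q : Matrix B B ℂ}
    (hQ : IsDensityOperator Q) : IsQuantumChannel (measurePrepare (1 : Matrix A A ℂ) Q) := by
  refine ⟨isCompletelyPositive_measurePrepare .one hQ.1, fun X => ?_⟩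
  rw [measurePrepare_apply, Matrix.trace_smul, hQ.2]
  simp [Matrix.one_apply, Matrix.trace]

end Channels

/-- The map `Y ↦ Q ⊗ Y`. -/
def prepare (Q : Matrix C C ℂ) (B : Type*) : Superop B (C × B) where
  toFun Y := Matrix.kroneckerMap (· * ·) Q Y
  map_add' := Matrix.kronecker_add Q
  map_smul' c Y := Matrix.kronecker_smul c Q Y

theorem isQuantumChannel_prepare [Fintype B] [Fintype C] {Q : Matrix C C ℂ}
    (hQ : IsDensityOperator Q) : IsQuantumChannel (prepare Q B) := by
  classical
  refine ⟨fun n X hX => ?_, fun Y => ?_⟩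
  · exact (hQ.1.kronecker hX).submatrix fun p : Fin n × (C × B) => (p.2.1, (p.1, p.2.2))
  · change (Matrix.kroneckerMap (· * ·) Q Y).trace = _
    rw [Matrix.trace_kronecker, hQ.2, one_mul]

theorem tensorMap_apply [Fintype A] [DecidableEq A] [Fintype B] [DecidableEq B]
    {A' B' : Type*} (Φ : Superop A A') (Ψ : Superop B B')
    (X : Matrix (A × B) (A × B) ℂ) (p q : A' × B') :
    tensorMap Φ Ψ X p q = ∑ a, ∑ a', ∑ b, ∑ b', X (a, b) (a', b') *
      (Φ (Matrix.single a a' 1) p.1 q.1 * Ψ (Matrix.single b b' 1) p.2 q.2) := by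
  rw [tensorMap, LinearMap.comp_apply, tensorId_apply, superop_apply_apply_eq_sum]
  refine Finset.sum_congr rfl fun a _ => Finset.sum_congr rfl fun a' _ => ?_
  rw [Matrix.of_apply, idTensor_apply, superop_apply_apply_eq_sum Ψ]
  simp only [Finset.sum_mul, Matrix.of_apply]
  refine Finset.sum_congr rfl fun b _ => Finset.sum_congr rfl fun b' _ => ?_
  ring

end Superoperators

/-! ### The trace norm of Hermitian matrices. -/

section TraceNorm

variable {n : Type*} [Fintype n] [DecidableEq n]

/-- The eigenvalues of `X†X` and the squared eigenvalues of `X` are roots of the same characteristic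
polynomial. Comparing them as multisets avoids matching the two enumerations. -/
theorem traceNorm_eq_sum_abs_eigenvalues {X : Matrix n n ℂ} (hX : X.IsHermitian) :
    traceNorm X = ∑ i, |hX.eigenvalues i| := by
  have hsq : X.conjTranspose * X = cfc (fun x : ℝ => x ^ 2) X := by
    rw [cfc_pow_id (R := ℝ) X 2 (ha := hX.isSelfAdjoint), hX.eq, sq]
  have h₁ := (Matrix.isHermitian_conjTranspose_mul_self X).roots_charpoly_eq_eigenvalues
  have h₂ : (X.conjTranspose * X).charpoly.roots =
      Finset.univ.val.map fun i => ((hX.eigenvalues i ^ 2 : ℝ) : ℂ) := by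
    rw [hsq, hX.charpoly_cfc_eq]
    exact Polynomial.roots_multiset_prod_X_sub_C
      (Finset.univ.val.map fun i => ((hX.eigenvalues i ^ 2 : ℝ) : ℂ)) ▸
        (by rw [Multiset.map_map]; rfl)
  have h₃ := congrArg (fun s => (s.map fun z : ℂ => √z.re).sum) (h₁.symm.trans h₂)
  simp only [Multiset.map_map, Function.comp_def, Complex.ofReal_re, Real.sqrt_sq_eq_abs] at h₃
  exact h₃

theorem conjTranspose_mul_mul_eigenvectorUnitary {X : Matrix n n ℂ} (hX : X.IsHermitian) :
    (hX.eigenvectorUnitary : Matrix n n ℂ).conjTranspose * X * hX.eigenvectorUnitary =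
      Matrix.diagonal fun i => (hX.eigenvalues i : ℂ) := by
  have h := hX.conjStarAlgAut_star_eigenvectorUnitary
  rwa [Unitary.conjStarAlgAut_star_apply] at h

theorem eq_mul_diagonal_mul_conjTranspose {X : Matrix n n ℂ} (hX : X.IsHermitian) :
    X = (hX.eigenvectorUnitary : Matrix n n ℂ) *
      (Matrix.diagonal fun i => (hX.eigenvalues i : ℂ)) *
        (hX.eigenvectorUnitary : Matrix n n ℂ).conjTranspose := by
  have h := hX.spectral_theorem
  rwa [Unitary.conjStarAlgAut_apply] at h

theorem re_mul_diagonal_mul_conjTranspose_apply (W : Matrix n n ℂ) (μ : n → ℝ) (i : n) :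
    ((W * (Matrix.diagonal fun j => (μ j : ℂ)) * W.conjTranspose) i i).re =
      ∑ j, μ j * ‖W i j‖ ^ 2 := by
  rw [Matrix.mul_apply, Complex.re_sum]
  refine Finset.sum_congr rfl fun j _ => ?_
  rw [Matrix.mul_diagonal, Matrix.conjTranspose_apply, mul_right_comm, Complex.star_def,
    Complex.mul_conj, Complex.normSq_eq_norm_sq, ← Complex.ofReal_mul, Complex.ofReal_re, mul_comm]

theorem sum_norm_sq_col_eq_one {W : Matrix n n ℂ} (hW : W.conjTranspose * W = 1) (j : n) :
    ∑ i, ‖W i j‖ ^ 2 = 1 := by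
  have h := congrArg Complex.re (congrFun (congrFun hW j) j)
  rw [Matrix.mul_apply, Complex.re_sum, Matrix.one_apply_eq, Complex.one_re] at h
  rw [← h]
  refine Finset.sum_congr rfl fun i _ => ?_
  rw [Matrix.conjTranspose_apply, Complex.star_def, mul_comm, Complex.mul_conj,
    Complex.normSq_eq_norm_sq, Complex.ofReal_re]

/-- In any orthonormal basis the diagonal entries of `Y` are combinations of its eigenvalues with
weights `‖W i j‖²`, where `W` is unitary; each eigenvalue has total weight `1`. -/
theorem sum_mul_re_le_traceNorm {Y : Matrix n n ℂ} (hY : Y.IsHermitian)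
    (U : Matrix.unitaryGroup n ℂ) {s : n → ℝ} (hs : ∀ i, |s i| ≤ 1) :
    ∑ i, s i * (((U : Matrix n n ℂ).conjTranspose * Y * U) i i).re ≤ traceNorm Y := by
  set V : Matrix n n ℂ := (hY.eigenvectorUnitary : Matrix n n ℂ)
  have hV : V.conjTranspose * V = 1 := Matrix.mem_unitaryGroup_iff'.1 hY.eigenvectorUnitary.2
  have hU : (U : Matrix n n ℂ) * (U : Matrix n n ℂ).conjTranspose = 1 :=
    Matrix.mem_unitaryGroup_iff.1 U.2
  set W : Matrix n n ℂ := (U : Matrix n n ℂ).conjTranspose * V with hW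
  have hWW : W.conjTranspose * W = 1 := by
    rw [hW, Matrix.conjTranspose_mul, Matrix.conjTranspose_conjTranspose, Matrix.mul_assoc,
      ← Matrix.mul_assoc (U : Matrix n n ℂ), hU, Matrix.one_mul, hV]
  have hconj : (U : Matrix n n ℂ).conjTranspose * Y * U =
      W * (Matrix.diagonal fun i => (hY.eigenvalues i : ℂ)) * W.conjTranspose := by
    conv_lhs => rw [eq_mul_diagonal_mul_conjTranspose hY]
    simp only [hW, Matrix.conjTranspose_mul, Matrix.conjTranspose_conjTranspose, Matrix.mul_assoc]
    rfl
  rw [traceNorm_eq_sum_abs_eigenvalues hY, hconj]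
  simp only [re_mul_diagonal_mul_conjTranspose_apply, Finset.mul_sum]
  rw [Finset.sum_comm]
  refine Finset.sum_le_sum fun j _ => ?_
  calc ∑ i, s i * (hY.eigenvalues j * ‖W i j‖ ^ 2)
      ≤ ∑ i, |hY.eigenvalues j| * ‖W i j‖ ^ 2 := by
        refine Finset.sum_le_sum fun i _ => ?_
        rw [← mul_assoc]
        refine mul_le_mul_of_nonneg_right ?_ (sq_nonneg _)
        refine (le_abs_self _).trans ?_
        rw [abs_mul]
        exact mul_le_of_le_one_left (abs_nonneg _) (hs i)
    _ = |hY.eigenvalues j| := by rw [← Finset.mul_sum, sum_norm_sq_col_eq_one hWW, mul_one]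

/-- The trace norm of a Hermitian matrix is attained by a continuous functional that is bounded by
the trace norm. -/
theorem exists_continuous_eq_traceNorm {X : Matrix n n ℂ} (hX : X.IsHermitian) :
    ∃ f : Matrix n n ℂ → ℝ, Continuous f ∧ f X = traceNorm X ∧
      ∀ Y : Matrix n n ℂ, Y.IsHermitian → f Y ≤ traceNorm Y := by
  let U : Matrix n n ℂ := hX.eigenvectorUnitary
  -- The functional is `Y ↦ Re Tr (sgn(X) Y)`, written in an eigenbasis of `X`.
  refine ⟨fun Y => ∑ i, (SignType.sign (hX.eigenvalues i) : ℝ) * ((U.conjTranspose * Y * U) i i).re,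
    ?_, ?_, fun Y hY => sum_mul_re_le_traceNorm hY _ fun i => ?_⟩
  · refine continuous_finsetSum _ fun i _ => continuous_const.mul (Complex.continuous_re.comp ?_)
    exact Continuous.matrix_elem (by fun_prop) i i
  · rw [traceNorm_eq_sum_abs_eigenvalues hX]
    refine Finset.sum_congr rfl fun i _ => ?_
    simp only [U, conjTranspose_mul_mul_eigenvectorUnitary hX, Matrix.diagonal_apply_eq,
      Complex.ofReal_re, sign_mul_self]
  · rcases lt_trichotomy (hX.eigenvalues i) 0 with h | h | h <;> simp [h]

/-- In an eigenbasis of `ρ - σ`, each eigenvalue is a difference of nonnegative diagonal entries of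
`ρ` and `σ`. -/
theorem traceNorm_sub_le {ρ σ : Matrix n n ℂ} (hρ : ρ.PosSemidef) (hσ : σ.PosSemidef) :
    traceNorm (ρ - σ) ≤ ρ.trace.re + σ.trace.re := by
  have hX : (ρ - σ).IsHermitian := hρ.1.sub hσ.1
  set U : Matrix n n ℂ := (hX.eigenvectorUnitary : Matrix n n ℂ) with hU
  have hUU : U * U.conjTranspose = 1 := Matrix.mem_unitaryGroup_iff.1 hX.eigenvectorUnitary.2
  have htr : ∀ Y : Matrix n n ℂ, ∑ i, ((U.conjTranspose * Y * U) i i).re = Y.trace.re := by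
    intro Y
    rw [← Complex.re_sum]
    change (U.conjTranspose * Y * U).trace.re = _
    rw [Matrix.trace_mul_cycle, hUU, Matrix.one_mul]
  rw [traceNorm_eq_sum_abs_eigenvalues hX, ← htr ρ, ← htr σ, ← Finset.sum_add_distrib]
  refine Finset.sum_le_sum fun i _ => ?_
  have h := congrArg Complex.re
    (congrFun (congrFun (conjTranspose_mul_mul_eigenvectorUnitary hX) i) i)
  rw [Matrix.diagonal_apply_eq, Complex.ofReal_re, ← hU, Matrix.mul_sub, Matrix.sub_mul,
    Matrix.sub_apply, Complex.sub_re] at h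
  have h₁ := (Complex.le_def.1 ((hρ.conjTranspose_mul_mul_same U).diag_nonneg (i := i))).1
  have h₂ := (Complex.le_def.1 ((hσ.conjTranspose_mul_mul_same U).diag_nonneg (i := i))).1
  rw [Complex.zero_re] at h₁ h₂
  rw [← h, abs_le]
  constructor <;> linarith

end TraceNorm

/-! ### Diamond distance of channels: bounds and lower semicontinuity. -/

section DiamondNorm

variable {A B : Type*}

theorem isDensityOperator_vecMulVec [Fintype A] {ψ : A → ℂ} (hψ : ∑ p, ‖ψ p‖ ^ 2 = 1) :
    IsDensityOperator (Matrix.vecMulVec ψ (star ψ)) := by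
  refine ⟨Matrix.posSemidef_vecMulVec_self_star ψ, ?_⟩
  rw [Matrix.trace, ← Complex.ofReal_one, ← hψ, Complex.ofReal_sum]
  refine Finset.sum_congr rfl fun p _ => ?_
  rw [Matrix.diag_apply, Matrix.vecMulVec_apply, Pi.star_apply, Complex.star_def, Complex.mul_conj,
    Complex.normSq_eq_norm_sq]

theorem idTensor_smul_sub_apply (R : Type*) (c : ℂ) (N L : Superop A B)
    (X : Matrix (R × A) (R × A) ℂ) :
    idTensor R (c • (N - L)) X = idTensor R (c • N) X - idTensor R (c • L) X := by
  ext p q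
  simp [idTensor_apply, mul_sub]

theorem idTensor_smul_apply (R : Type*) (c : ℂ) (N : Superop A B)
    (X : Matrix (R × A) (R × A) ℂ) : idTensor R (c • N) X = c • idTensor R N X := rfl

theorem isHermitian_idTensor_sub [Fintype A] [Fintype B] {N L : Superop A B} (hN : IsQuantumChannel N)
    (hL : IsQuantumChannel L) (ψ : A × A → ℂ) :
    (idTensor A (N - L) (Matrix.vecMulVec ψ (star ψ))).IsHermitian := by
  have h := idTensor_smul_sub_apply A 1 N L (Matrix.vecMulVec ψ (star ψ))
  rw [one_smul, one_smul, one_smul] at h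
  rw [h]
  have hψ := Matrix.posSemidef_vecMulVec_self_star ψ
  exact (hN.idTensor.1.posSemidef hψ).1.sub (hL.idTensor.1.posSemidef hψ).1

variable [Fintype A] [DecidableEq A] [Fintype B] [DecidableEq B]

theorem traceNorm_idTensor_smul_sub_le {N L : Superop A B} (hN : IsQuantumChannel N)
    (hL : IsQuantumChannel L) {c : ℝ} (hc : 0 ≤ c) {ρ : Matrix (A × A) (A × A) ℂ}
    (hρ : IsDensityOperator ρ) : traceNorm (idTensor A ((c : ℂ) • (N - L)) ρ) ≤ 2 * c := by
  have h₁ := hN.idTensor.isDensityOperator (A := A × A) hρ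
  have h₂ := hL.idTensor.isDensityOperator (A := A × A) hρ
  rw [idTensor_smul_sub_apply, idTensor_smul_apply, idTensor_smul_apply]
  have hc' : (0 : ℂ) ≤ c := Complex.zero_le_real.2 hc
  refine (traceNorm_sub_le (h₁.1.smul hc') (h₂.1.smul hc')).trans_eq ?_
  rw [Matrix.trace_smul, Matrix.trace_smul, h₁.2, h₂.2]
  simp
  ring

theorem diamondNorm_smul_sub_le {N L : Superop A B} (hN : IsQuantumChannel N)
    (hL : IsQuantumChannel L) {c : ℝ} (hc : 0 ≤ c) :
    diamondNorm ((c : ℂ) • (N - L)) ≤ 2 * c := by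
  refine Real.sSup_le ?_ (by positivity)
  rintro r ⟨ψ, hψ, rfl⟩
  exact traceNorm_idTensor_smul_sub_le hN hL hc (isDensityOperator_vecMulVec hψ)

theorem traceNorm_le_diamondNorm_sub {N L : Superop A B} (hN : IsQuantumChannel N)
    (hL : IsQuantumChannel L) {ψ : A × A → ℂ} (hψ : ∑ p, ‖ψ p‖ ^ 2 = 1) :
    traceNorm (idTensor A (N - L) (Matrix.vecMulVec ψ (star ψ))) ≤ diamondNorm (N - L) := by
  refine le_csSup ⟨2, ?_⟩ ⟨ψ, hψ, rfl⟩
  rintro r ⟨φ, hφ, rfl⟩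
  have h := traceNorm_idTensor_smul_sub_le hN hL zero_le_one (isDensityOperator_vecMulVec hφ)
  rwa [Complex.ofReal_one, one_smul, mul_one] at h

/-- A strict lower bound at `G₀` is witnessed by one input `ψ` and one continuous functional
dominated by the trace norm, so it persists nearby. Lower semicontinuity is all that attaining a
minimum requires. -/
theorem lowerSemicontinuousOn_diamondNorm_sub_ofChoi [Nonempty A] {N : Superop A B}
    (hN : IsQuantumChannel N) :
    LowerSemicontinuousOn (fun G : Matrix (A × B) (A × B) ℂ => diamondNorm (N - ofChoi G))
      {G | IsQuantumChannel (ofChoi G)} := by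
  intro G₀ hG₀ y hy
  have hne : {r : ℝ | ∃ ψ : A × A → ℂ, ∑ p, ‖ψ p‖ ^ 2 = 1 ∧
      r = traceNorm (idTensor A (N - ofChoi G₀) (Matrix.vecMulVec ψ (star ψ)))}.Nonempty := by
    obtain ⟨a⟩ := ‹Nonempty A›
    refine ⟨_, Pi.single (a, a) 1, ?_, rfl⟩
    rw [Finset.sum_eq_single (a, a)] <;> simp +contextual
  obtain ⟨_, ⟨ψ, hψ, rfl⟩, hlt⟩ := exists_lt_of_lt_csSup hne hy
  obtain ⟨f, hf, hf₀, hfle⟩ :=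
    exists_continuous_eq_traceNorm (isHermitian_idTensor_sub hN hG₀ ψ)
  have hcont : Continuous fun G : Matrix (A × B) (A × B) ℂ =>
      f (idTensor A (N - ofChoi G) (Matrix.vecMulVec ψ (star ψ))) := by
    refine hf.comp (continuous_matrix fun p q => ?_)
    simp only [idTensor_apply, LinearMap.sub_apply, Matrix.sub_apply, ofChoi_apply]
    refine continuous_const.sub (continuous_finsetSum _ fun a _ =>
      continuous_finsetSum _ fun a' _ => continuous_const.mul ?_)
    exact continuous_id.matrix_elem _ _
  rw [← hf₀] at hlt
  filter_upwards [mem_nhdsWithin_of_mem_nhds (hcont.continuousAt.eventually (lt_mem_nhds hlt)),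
    self_mem_nhdsWithin] with G hG hGc
  exact hG.trans_le ((hfle _ (isHermitian_idTensor_sub hN hGc ψ)).trans
    (traceNorm_le_diamondNorm_sub hN hGc hψ))

end DiamondNorm

/-! ### Carathéodory's theorem, compact convex hulls and the cones over them. -/

section ConvexHull

variable {E : Type*} [AddCommGroup E] [Module ℝ E]

/-- This is Carathéodory's theorem with a fixed number of points, shorter combinations being padded
by zero weights. It yields both compactness of hulls and finite decompositions. -/
theorem convexHull_eq_image_stdSimplex [FiniteDimensional ℝ E] (S : Set E) :
    convexHull ℝ S = (fun p : (Fin (Module.finrank ℝ E + 1) → ℝ) ×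
      (Fin (Module.finrank ℝ E + 1) → E) => ∑ i, p.1 i • p.2 i) ''
        (stdSimplex ℝ (Fin (Module.finrank ℝ E + 1)) ×ˢ Set.univ.pi fun _ => S) := by
  apply Set.Subset.antisymm
  · intro x hx
    obtain ⟨ι, _, z, w, hz, hind, hw, hw₁, rfl⟩ := eq_pos_convex_span_of_mem_convexHull hx
    have hcard : Fintype.card ι ≤ Fintype.card (Fin (Module.finrank ℝ E + 1)) := by
      rw [Fintype.card_fin]
      exact hind.card_le_finrank_succ.trans
        (Nat.succ_le_succ (Submodule.finrank_le (vectorSpan ℝ (Set.range z))))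
    obtain ⟨e⟩ := Function.Embedding.nonempty_of_card_le hcard
    have hne : Nonempty ι := by
      by_contra h
      rw [not_nonempty_iff] at h
      simp at hw₁
    have hext : ∀ i ∉ Set.range e, Function.extend e w 0 i = 0 := fun i hi =>
      Function.extend_apply' _ _ _ fun ⟨j, hj⟩ => hi ⟨j, hj⟩
    have hinv : ∀ i, Function.invFun e (e i) = i := Function.leftInverse_invFun e.injective
    refine ⟨(Function.extend e w 0, fun i => z (Function.invFun e i)), ⟨⟨fun i => ?_, ?_⟩, ?_⟩, ?_⟩
    · by_cases hi : i ∈ Set.range e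
      · obtain ⟨j, rfl⟩ := hi
        exact ((hw j).trans_eq (e.injective.extend_apply w 0 j).symm).le
      · exact (hext i hi).ge
    · rw [← hw₁]
      exact (Fintype.sum_of_injective e e.injective _ _ hext fun i =>
        (e.injective.extend_apply w 0 i).symm).symm
    · exact fun i _ => hz ⟨_, rfl⟩
    · refine (Fintype.sum_of_injective e e.injective _ _ (fun i hi => ?_)
        fun i => ?_).symm
      · simp only [hext i hi, zero_smul]
      · simp only [e.injective.extend_apply, hinv]
  · rintro _ ⟨⟨w, z⟩, ⟨hw, hz⟩, rfl⟩
    exact (convex_convexHull ℝ S).sum_mem (fun i _ => hw.1 i) hw.2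
      fun i _ => subset_convexHull ℝ S (hz i trivial)

/-- The normalized part of a combination is the mean of the normalized parts, weighted by their
`τ`-masses. If the total mass vanishes, both terms are zero and any `s ∈ K` serves. -/
theorem convex_cone_of_convex {K : Set E} (hK : Convex ℝ K) (τ : E →ₗ[ℝ] ℝ) :
    Convex ℝ {x | 0 ≤ τ x ∧ ∃ s ∈ K, τ x • s = x} := by
  rintro x ⟨hx, s, hs, hsx⟩ y ⟨hy, t, ht, hty⟩ a b ha hb hab
  have hxy : τ (a • x + b • y) = a * τ x + b * τ y := by simp
  refine ⟨by rw [hxy]; positivity, ?_⟩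
  rcases (by positivity : 0 ≤ a * τ x + b * τ y).eq_or_lt with h | h
  · refine ⟨s, hs, ?_⟩
    have h₁ : a * τ x = 0 := by nlinarith [mul_nonneg ha hx, mul_nonneg hb hy]
    have h₂ : b * τ y = 0 := by nlinarith [mul_nonneg ha hx, mul_nonneg hb hy]
    rw [hxy, ← h, zero_smul]
    nth_rewrite 1 [← hsx]
    nth_rewrite 1 [← hty]
    rw [smul_smul, smul_smul, h₁, h₂, zero_smul, zero_smul, add_zero]
  · refine ⟨(a * τ x / (a * τ x + b * τ y)) • s + (b * τ y / (a * τ x + b * τ y)) • t,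
      hK hs ht (by positivity) (by positivity) ?_, ?_⟩
    · rw [← add_div, div_self h.ne']
    · rw [hxy, smul_add, smul_smul, smul_smul, mul_div_cancel₀ _ h.ne', mul_div_cancel₀ _ h.ne',
        mul_smul, mul_smul, hsx, hty]

variable [TopologicalSpace E] [ContinuousSMul ℝ E]

theorem IsCompact.convexHull_of_finiteDimensional [ContinuousAdd E] [FiniteDimensional ℝ E] {S : Set E}
    (hS : IsCompact S) : IsCompact (convexHull ℝ S) := by
  rw [convexHull_eq_image_stdSimplex]
  refine ((isCompact_stdSimplex ℝ _).prod (isCompact_univ_pi fun _ => hS)).image ?_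
  fun_prop

theorem isClosed_cone_of_isCompact [T2Space E] [FirstCountableTopology E] {K : Set E}
    (hK : IsCompact K) (τ : E →L[ℝ] ℝ) :
    IsClosed {x | 0 ≤ τ x ∧ ∃ s ∈ K, τ x • s = x} := by
  refine IsSeqClosed.isClosed fun u x hu hx => ?_
  choose h₀ s hs hsu using hu
  obtain ⟨y, hy, φ, hφ, hlim⟩ := hK.isSeqCompact hs
  have hτu := (τ.continuous.tendsto x).comp hx
  refine ⟨ge_of_tendsto' hτu h₀, y, hy, ?_⟩
  have h₁ := (hτu.comp hφ.tendsto_atTop).smul hlim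
  have h₂ := hx.comp hφ.tendsto_atTop
  refine tendsto_nhds_unique h₁ (h₂.congr fun n => ?_)
  exact (hsu (φ n)).symm

end ConvexHull

/-! ### Compactness of the sets of states and of Choi matrices of channels. -/

section DensityOperators

variable {A B : Type*} [Fintype A] [Fintype B]

/-- Nonnegativity of the `2 × 2` principal minor gives `|G i j|² ≤ G i i · G j j`. -/
theorem Matrix.PosSemidef.norm_apply_le_trace {G : Matrix A A ℂ} (hG : G.PosSemidef) (i j : A) :
    ‖G i j‖ ≤ G.trace.re := by
  have hd : ∀ i, 0 ≤ (G i i).re := fun i => (Complex.le_def.1 (hG.diag_nonneg (i := i))).1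
  have hi : ∀ i, (G i i : ℂ) = ((G i i).re : ℂ) := fun i =>
    (hG.1.coe_re_apply_self i).symm
  have hle : ∀ i, (G i i).re ≤ G.trace.re := fun i => by
    rw [Matrix.trace, Complex.re_sum]
    exact Finset.single_le_sum (f := fun i => (G i i).re) (fun i _ => hd i) (Finset.mem_univ i)
  have h := (hG.submatrix ![i, j]).det_nonneg
  rw [Matrix.det_fin_two] at h
  simp only [Matrix.submatrix_apply, Matrix.cons_val_zero, Matrix.cons_val_one] at h
  rw [← hG.1.apply j i, Complex.star_def, Complex.mul_conj, hi i, hi j, ← Complex.ofReal_mul,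
    ← Complex.ofReal_sub, Complex.zero_le_real, Complex.normSq_eq_norm_sq] at h
  nlinarith [hle i, hle j, hd i, hd j, norm_nonneg (G i j)]

theorem isClosed_posSemidef : IsClosed {G : Matrix A A ℂ | G.PosSemidef} := by
  simp only [Matrix.posSemidef_iff_dotProduct_mulVec, Set.ofPred_and, Set.ofPred_forall]
  refine (isClosed_eq (by fun_prop) (by fun_prop)).inter (isClosed_iInter fun x => ?_)
  exact isClosed_le continuous_const (by fun_prop)

theorem isCompact_setOf_norm_apply_le (A B : Type*) [Finite A] [Finite B] (c : ℝ) :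
    IsCompact {G : Matrix A B ℂ | ∀ i j, ‖G i j‖ ≤ c} := by
  have h : {G : Matrix A B ℂ | ∀ i j, ‖G i j‖ ≤ c} =
      Set.univ.pi fun _ : A => Set.univ.pi fun _ : B => Metric.closedBall (0 : ℂ) c := by
    ext G
    exact ⟨fun h i _ j _ => mem_closedBall_zero_iff.2 (h i j),
      fun h i j => mem_closedBall_zero_iff.1 (h i trivial j trivial)⟩
  rw [h]
  exact isCompact_univ_pi fun _ => isCompact_univ_pi fun _ => isCompact_closedBall 0 c

theorem isCompact_setOf_isDensityOperator : IsCompact {G : Matrix A A ℂ | IsDensityOperator G} := by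
  refine (isCompact_setOf_norm_apply_le A A 1).of_isClosed_subset ?_ fun G hG i j => ?_
  · have : {G : Matrix A A ℂ | IsDensityOperator G} = {G | G.PosSemidef} ∩ {G | G.trace = 1} :=
      Set.ext fun G => ⟨fun h => ⟨h.1, h.2⟩, fun h => ⟨h.1, h.2⟩⟩
    rw [this]
    exact isClosed_posSemidef.inter (isClosed_eq (by fun_prop) continuous_const)
  · simpa [hG.2] using hG.1.norm_apply_le_trace i j

theorem trace_choi_of_trace_eq [DecidableEq A] {Φ : Superop A B}
    (hΦ : ∀ X : Matrix A A ℂ, (Φ X).trace = X.trace) : (choi Φ).trace = Fintype.card A := by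
  have h : ∀ a, ∑ b, Φ (Matrix.single a a 1) b b = 1 := fun a =>
    (hΦ _).trans (Matrix.trace_single_eq_same a 1)
  simp [Matrix.trace, Fintype.sum_prod_type, choi, h]

theorem isClosed_setOf_trace_ofChoi_eq (A B : Type*) [Fintype A] [Fintype B] :
    IsClosed {G : Matrix (A × B) (A × B) ℂ |
      ∀ X : Matrix A A ℂ, (ofChoi G X).trace = X.trace} := by
  rw [Set.ofPred_forall]
  refine isClosed_iInter fun X => isClosed_eq ?_ continuous_const
  simp only [Matrix.trace, Matrix.diag_apply, ofChoi_apply]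
  fun_prop

theorem isCompact_setOf_isQuantumChannel_ofChoi (A B : Type*) [Fintype A] [Fintype B] :
    IsCompact {G : Matrix (A × B) (A × B) ℂ | IsQuantumChannel (ofChoi G)} := by
  classical
  have : {G : Matrix (A × B) (A × B) ℂ | IsQuantumChannel (ofChoi G)} =
      {G | G.PosSemidef} ∩ {G | ∀ X : Matrix A A ℂ, (ofChoi G X).trace = X.trace} := by
    ext G
    refine ⟨fun h => ⟨?_, h.2⟩, fun h => ⟨isCompletelyPositive_ofChoi h.1, h.2⟩⟩
    exact choi_ofChoi G ▸ h.1.posSemidef_choi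
  refine (isCompact_setOf_norm_apply_le _ _ (Fintype.card A)).of_isClosed_subset ?_
    fun G hG i j => ?_
  · rw [this]
    exact isClosed_posSemidef.inter (isClosed_setOf_trace_ofChoi_eq A B)
  · have h := (choi_ofChoi G ▸ hG.1.posSemidef_choi : G.PosSemidef).norm_apply_le_trace i j
    rwa [← choi_ofChoi G, trace_choi_of_trace_eq hG.2, choi_ofChoi, Complex.natCast_re] at h

end DensityOperators

/-! ### Compactness of one-way LOCC and existence of a closest element. -/

section OneWayLOCC

variable {A B A' B' : Type*}

/-- The Choi matrix of a tensor product of superoperators. -/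
def choiTensor (G : Matrix (A × A') (A × A') ℂ) (H : Matrix (B × B') (B × B') ℂ) :
    Matrix ((A × B) × (A' × B')) ((A × B) × (A' × B')) ℂ :=
  Matrix.of fun p q =>
    G (p.1.1, p.2.1) (q.1.1, q.2.1) * H (p.1.2, p.2.2) (q.1.2, q.2.2)

theorem choi_sum [DecidableEq A] {ι : Type*} (s : Finset ι) (Φ : ι → Superop A B) :
    choi (∑ i ∈ s, Φ i) = ∑ i ∈ s, choi (Φ i) := by
  ext p q
  simp [choi, Matrix.sum_apply]

theorem ofChoi_sum [Fintype A] {ι : Type*} (s : Finset ι)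
    (G : ι → Matrix (A × B) (A × B) ℂ) : ofChoi (∑ i ∈ s, G i) = ∑ i ∈ s, ofChoi (G i) := by
  classical
  rw [← ofChoi_choi (∑ i ∈ s, ofChoi (G i)), choi_sum]
  simp only [choi_ofChoi]

variable [Fintype A] [DecidableEq A] [Fintype B] [DecidableEq B]

/-- Local operations commute; this order, with Alice acting first, is the one of the message
protocol. -/
theorem tensorMap_eq_comp (Φ : Superop A A') (Ψ : Superop B B') :
    tensorMap Φ Ψ = idTensor A' Ψ ∘ₗ tensorId Φ B := by
  refine LinearMap.ext fun X => ?_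
  ext p q
  rw [tensorMap_apply, LinearMap.comp_apply, idTensor_apply, superop_apply_apply_eq_sum Ψ]
  have h : ∀ b b', tensorId Φ B X (p.1, b) (q.1, b') =
      ∑ a, ∑ a', X (a, b) (a', b') * Φ (Matrix.single a a' 1) p.1 q.1 := fun b b' =>
    superop_apply_apply_eq_sum Φ _ _ _
  simp only [Matrix.of_apply, h, Finset.sum_mul, mul_assoc]
  calc _ = ∑ a, ∑ b, ∑ b', ∑ a', X (a, b) (a', b') *
        (Φ (Matrix.single a a' 1) p.1 q.1 * Ψ (Matrix.single b b' 1) p.2 q.2) :=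
        Finset.sum_congr rfl fun a _ => by
          rw [Finset.sum_comm]
          exact Finset.sum_congr rfl fun b _ => Finset.sum_comm
    _ = _ := by
        rw [Finset.sum_comm]
        exact Finset.sum_congr rfl fun b _ => Finset.sum_comm

theorem ofChoi_choiTensor (G : Matrix (A × A') (A × A') ℂ) (H : Matrix (B × B') (B × B') ℂ) :
    ofChoi (choiTensor G H) = tensorMap (ofChoi G) (ofChoi H) := by
  refine LinearMap.ext fun X => ?_
  ext p q
  have hG : ∀ a a', ofChoi G (Matrix.single a a' 1) p.1 q.1 = G (a, p.1) (a', q.1) := fun a a' =>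
    congrFun (congrFun (choi_ofChoi G) (a, p.1)) (a', q.1)
  have hH : ∀ b b', ofChoi H (Matrix.single b b' 1) p.2 q.2 = H (b, p.2) (b', q.2) := fun b b' =>
    congrFun (congrFun (choi_ofChoi H) (b, p.2)) (b', q.2)
  simp only [tensorMap_apply, ofChoi_apply, hG, hH, choiTensor, Matrix.of_apply,
    Fintype.sum_prod_type]
  exact Finset.sum_congr rfl fun a _ => Finset.sum_comm

theorem choi_tensorMap (Φ : Superop A A') (Ψ : Superop B B') :
    choi (tensorMap Φ Ψ) = choiTensor (choi Φ) (choi Ψ) := by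
  rw [← choi_ofChoi (choiTensor (choi Φ) (choi Ψ)), ofChoi_choiTensor, ofChoi_choi, ofChoi_choi]

theorem tensorMap_kronecker (Φ : Superop A A') (Ψ : Superop B B')
    (X : Matrix A A ℂ) (Y : Matrix B B ℂ) :
    tensorMap Φ Ψ (Matrix.kroneckerMap (· * ·) X Y) =
      Matrix.kroneckerMap (· * ·) (Φ X) (Ψ Y) := by
  ext p q
  rw [tensorMap_apply, Matrix.kroneckerMap_apply, superop_apply_apply_eq_sum Φ,
    superop_apply_apply_eq_sum Ψ, Finset.sum_mul]
  refine Finset.sum_congr rfl fun a _ => ?_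
  rw [Finset.sum_mul]
  refine Finset.sum_congr rfl fun a' _ => ?_
  rw [Finset.mul_sum]
  refine Finset.sum_congr rfl fun b _ => ?_
  rw [Finset.mul_sum]
  refine Finset.sum_congr rfl fun b' _ => ?_
  rw [Matrix.kroneckerMap_apply]
  ring

variable [Fintype A'] [Fintype B']

theorem isQuantumChannel_of_mem_oneWayLOCC {L : Superop (A × B) (A' × B')}
    (hL : L ∈ oneWayLOCC A B A' B') : IsQuantumChannel L := by
  obtain ⟨n, ℰ, ℱ, hℰ, htr, hℱ, rfl⟩ := hL
  refine ⟨isCompletelyPositive_sum _ fun y _ => (hℰ y).tensorId.comp (hℱ y).1.idTensor,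
    fun X => ?_⟩
  have h : ∀ y, (tensorMap (ℰ y) (ℱ y) X).trace = (tensorId (ℰ y) B X).trace := fun y => by
    rw [tensorMap_eq_comp]
    exact (hℱ y).idTensor.2 _
  have h' : ∑ y, tensorId (ℰ y) B X = tensorId (∑ y, ℰ y) B X := by
    ext p q
    simp [tensorId_apply, Matrix.sum_apply]
  rw [LinearMap.sum_apply, Matrix.trace_sum]
  simp only [h]
  rw [← Matrix.trace_sum, h']
  simp only [Matrix.trace, Matrix.diag_apply, Fintype.sum_prod_type_right, tensorId_apply]
  exact Finset.sum_congr rfl fun r _ => htr (Matrix.of fun a a' => X (a, r) (a', r))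

/-- The Choi matrices of `ℰ ⊗ ℱ` with `ℱ` a channel and `ℰ` completely positive, normalized to have
a Choi matrix of trace one. -/
def productChois (A B A' B' : Type*) [Fintype A] [Fintype B] [Fintype A'] [Fintype B'] :
    Set (Matrix ((A × B) × (A' × B')) ((A × B) × (A' × B')) ℂ) :=
  Set.image2 choiTensor {G : Matrix (A × A') (A × A') ℂ | IsDensityOperator G}
    {H : Matrix (B × B') (B × B') ℂ | IsQuantumChannel (ofChoi H)}

theorem isCompact_productChois (A B A' B' : Type*) [Fintype A] [Fintype B] [Fintype A']
    [Fintype B'] : IsCompact (productChois A B A' B') := by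
  rw [productChois, ← Set.image_prod]
  refine (isCompact_setOf_isDensityOperator.prod
    (isCompact_setOf_isQuantumChannel_ofChoi B B')).image ?_
  refine continuous_matrix fun p q => ?_
  exact (continuous_fst.matrix_elem _ _).mul (continuous_snd.matrix_elem _ _)

theorem choi_mem_smul_convexHull_of_mem_oneWayLOCC [Nonempty A] {L : Superop (A × B) (A' × B')}
    (hL : L ∈ oneWayLOCC A B A' B') :
    choi L ∈ (fun G => (Fintype.card A : ℝ) • G) '' convexHull ℝ (productChois A B A' B') := by
  classical
  obtain ⟨n, ℰ, ℱ, hℰ, htr, hℱ, rfl⟩ := hL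
  have hA : (Fintype.card A : ℝ) ≠ 0 := by simp
  let t : Fin n → ℝ := fun y => (choi (ℰ y)).trace.re
  have ht : ∀ y, (choi (ℰ y)).trace = t y := fun y =>
    Complex.eq_re_of_ofReal_le (r := 0) (by simpa using (hℰ y).posSemidef_choi.trace_nonneg)
  have ht₀ : ∀ y, 0 ≤ t y := fun y =>
    (Complex.le_def.1 (hℰ y).posSemidef_choi.trace_nonneg).1
  have hsum : ∑ y, t y = Fintype.card A := by
    have h := trace_choi_of_trace_eq htr
    rw [choi_sum, Matrix.trace_sum] at h
    simp only [ht] at h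
    exact_mod_cast h
  have hz : ∀ y, t y = 0 → choi (ℰ y) = 0 := fun y hy =>
    (hℰ y).posSemidef_choi.trace_eq_zero_iff.1 (by rw [ht, hy, Complex.ofReal_zero])
  -- Outcomes whose Choi matrix has trace zero vanish and are dropped; the others are normalized,
  -- and their weights sum to `1` because the instrument has Choi trace `|A|`.
  refine ⟨∑ y with t y ≠ 0, (t y / Fintype.card A) •
    choiTensor ((t y)⁻¹ • choi (ℰ y)) (choi (ℱ y)), ?_, ?_⟩
  · refine (convex_convexHull ℝ _).sum_mem (fun y _ => by have := ht₀ y; positivity) ?_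
      fun y hy => subset_convexHull ℝ _ ⟨_, ⟨?_, ?_⟩, _, ?_, rfl⟩
    · rw [Finset.sum_filter_of_ne fun y _ h => by
        contrapose! h
        rw [h, zero_div], ← Finset.sum_div, hsum, div_self hA]
    · exact (hℰ y).posSemidef_choi.smul (inv_nonneg.2 (ht₀ y))
    · rw [Matrix.trace_smul, ht, Complex.real_smul, ← Complex.ofReal_mul,
        inv_mul_cancel₀ (Finset.mem_filter.1 hy).2, Complex.ofReal_one]
    · rw [Set.mem_ofPred_eq, ofChoi_choi]
      exact hℱ y
  · change (Fintype.card A : ℝ) • _ = _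
    rw [choi_sum, Finset.smul_sum, ← Finset.sum_filter_of_ne (p := fun y => t y ≠ 0) (s := Finset.univ)
      (f := fun y => choi (tensorMap (ℰ y) (ℱ y)))]
    · refine Finset.sum_congr rfl fun y hy => ?_
      rw [smul_smul, mul_div_cancel₀ _ hA, choi_tensorMap]
      ext p q
      simp only [choiTensor, Matrix.smul_apply, Matrix.of_apply, Complex.real_smul]
      rw [← mul_assoc, ← mul_assoc, ← Complex.ofReal_mul,
        mul_inv_cancel₀ (Finset.mem_filter.1 hy).2, Complex.ofReal_one, one_mul]
    · intro y _ h
      contrapose! h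
      rw [choi_tensorMap, hz y h]
      ext p q
      simp [choiTensor]

theorem ofChoi_mem_oneWayLOCC [Nonempty B]
    {G : Matrix ((A × B) × (A' × B')) ((A × B) × (A' × B')) ℂ}
    (hG : G ∈ (fun G => (Fintype.card A : ℝ) • G) '' convexHull ℝ (productChois A B A' B'))
    (htr : ∀ X, (ofChoi G X).trace = X.trace) : ofChoi G ∈ oneWayLOCC A B A' B' := by
  obtain ⟨S, hS, rfl⟩ := hG
  rw [convexHull_eq_image_stdSimplex] at hS
  obtain ⟨⟨w, z⟩, ⟨hw, hz⟩, rfl⟩ := hS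
  choose P hP Q hQ hPQ using fun i => hz i trivial
  have hdec : ofChoi ((Fintype.card A : ℝ) • ∑ i, w i • z i) =
      ∑ i, tensorMap (ofChoi ((Fintype.card A * w i : ℝ) • P i)) (ofChoi (Q i)) := by
    simp only [← ofChoi_choiTensor, ← ofChoi_sum, Finset.smul_sum]
    congr 1
    refine Finset.sum_congr rfl fun i _ => ?_
    rw [show z i = choiTensor (P i) (Q i) from (hPQ i).symm]
    ext p q
    simp only [choiTensor, Matrix.smul_apply, Matrix.of_apply, Complex.real_smul]
    push_cast
    ring
  refine ⟨_, _, _, fun i => isCompletelyPositive_ofChoi ?_, fun X => ?_, fun i => hQ i, hdec⟩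
  · have hc : 0 ≤ (Fintype.card A * w i : ℝ) := mul_nonneg (Nat.cast_nonneg _) (hw.1 i)
    exact (hP i).1.smul hc
  · obtain ⟨b⟩ := ‹Nonempty B›
    -- Fixing a state of Bob isolates Alice's total map, since each of Bob's channels preserves the
    -- trace.
    have h := htr (Matrix.kroneckerMap (· * ·) X (Matrix.single b b 1))
    have hs : (Matrix.single b b (1 : ℂ)).trace = 1 := Matrix.trace_single_eq_same b 1
    change (ofChoi ((Fintype.card A : ℝ) • ∑ i, w i • z i) _).trace = _ at h
    rw [hdec, LinearMap.sum_apply, Matrix.trace_sum, Matrix.trace_kronecker, hs, mul_one] at h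
    rw [← h, LinearMap.sum_apply, Matrix.trace_sum]
    refine Finset.sum_congr rfl fun i _ => ?_
    rw [tensorMap_kronecker, Matrix.trace_kronecker, (hQ i).2, hs, mul_one]

/-- The number of outcomes is unbounded, but up to the scale `|A|` the Choi matrices fill the
trace-preserving slice of the convex hull of a compact set. -/
theorem isCompact_choi_image_oneWayLOCC [Nonempty A] [Nonempty B] :
    IsCompact (choi '' oneWayLOCC A B A' B') := by
  have h : choi '' oneWayLOCC A B A' B' =
      ((fun G => (Fintype.card A : ℝ) • G) '' convexHull ℝ (productChois A B A' B')) ∩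
        {G | ∀ X, (ofChoi G X).trace = X.trace} := by
    apply Set.Subset.antisymm
    · rintro _ ⟨L, hL, rfl⟩
      refine ⟨choi_mem_smul_convexHull_of_mem_oneWayLOCC hL, fun X => ?_⟩
      rw [ofChoi_choi]
      exact (isQuantumChannel_of_mem_oneWayLOCC hL).2 X
    · rintro G ⟨hG, htr⟩
      exact ⟨ofChoi G, ofChoi_mem_oneWayLOCC hG htr, choi_ofChoi G⟩
  rw [h]
  exact ((isCompact_productChois A B A' B').convexHull_of_finiteDimensional.image
    (continuous_const_smul _)).inter_right (isClosed_setOf_trace_ofChoi_eq _ _)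

theorem exists_isMinOn_diamondNorm_sub [DecidableEq A'] [DecidableEq B'] [Nonempty A] [Nonempty B]
    {N : Superop (A × B) (A' × B')} (hN : IsQuantumChannel N)
    (hne : (oneWayLOCC A B A' B').Nonempty) :
    ∃ L ∈ oneWayLOCC A B A' B', ∀ L' ∈ oneWayLOCC A B A' B',
      diamondNorm (N - L) ≤ diamondNorm (N - L') := by
  have hsub : choi '' oneWayLOCC A B A' B' ⊆ {G | IsQuantumChannel (ofChoi G)} := by
    rintro _ ⟨L, hL, rfl⟩
    rw [Set.mem_ofPred_eq, ofChoi_choi]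
    exact isQuantumChannel_of_mem_oneWayLOCC hL
  obtain ⟨_, ⟨L, hL, rfl⟩, hmin⟩ :=
    ((lowerSemicontinuousOn_diamondNorm_sub_ofChoi hN).mono hsub).exists_isMinOn (hne.image choi)
      isCompact_choi_image_oneWayLOCC
  refine ⟨L, hL, fun L' hL' => ?_⟩
  have h := hmin (Set.mem_image_of_mem choi hL')
  simpa only [Set.mem_ofPred_eq, ofChoi_choi] using h

end OneWayLOCC

/-! ### Moments of complex Gaussian vectors. -/

section GaussianMoments

open MeasureTheory

/-- The density of the standard complex Gaussian distribution. -/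
noncomputable def gaussianDensity (z : ℂ) : NNReal :=
  Real.toNNReal (Real.pi⁻¹ * Real.exp (-‖z‖ ^ 2))

theorem coe_gaussianDensity (z : ℂ) :
    (gaussianDensity z : ℝ) = Real.pi⁻¹ * Real.exp (-‖z‖ ^ 2) :=
  Real.coe_toNNReal _ (by positivity)

theorem measurable_gaussianDensity : Measurable gaussianDensity := by
  unfold gaussianDensity
  fun_prop

/-- The standard complex Gaussian distribution. -/
noncomputable def complexGaussian : Measure ℂ :=
  volume.withDensity fun z => (gaussianDensity z : ENNReal)

theorem integral_norm_pow_mul_gaussianDensity (m : ℕ) :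
    ∫ z : ℂ, ‖z‖ ^ m * (gaussianDensity z : ℝ) = Real.Gamma ((m + 2) / 2) := by
  have h := Complex.integral_rpow_mul_exp_neg_rpow (p := 2) (q := m) one_le_two
    (by linarith [(Nat.cast_nonneg m : (0 : ℝ) ≤ m)])
  simp only [Real.rpow_natCast, Real.rpow_two] at h
  simp only [coe_gaussianDensity, mul_left_comm _ Real.pi⁻¹]
  rw [integral_const_mul, h]
  field_simp

theorem integrable_norm_pow_mul_gaussianDensity (m : ℕ) :
    Integrable fun z : ℂ => ‖z‖ ^ m * (gaussianDensity z : ℝ) := by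
  refine Integrable.of_integral_ne_zero ?_
  rw [integral_norm_pow_mul_gaussianDensity]
  exact (Real.Gamma_pos_of_pos (by positivity)).ne'

instance isProbabilityMeasure_complexGaussian : IsProbabilityMeasure complexGaussian := by
  refine ⟨?_⟩
  have h := ofReal_integral_eq_lintegral_ofReal (integrable_norm_pow_mul_gaussianDensity 0)
    (Filter.Eventually.of_forall fun z => by positivity)
  rw [integral_norm_pow_mul_gaussianDensity] at h
  simp only [pow_zero, one_mul, ENNReal.ofReal_coe_nnreal] at h
  rw [complexGaussian, withDensity_apply _ MeasurableSet.univ, Measure.restrict_univ, ← h]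
  simp

theorem integral_complexGaussian (f : ℂ → ℂ) :
    ∫ z, f z ∂complexGaussian = ∫ z, ((gaussianDensity z : ℝ) : ℂ) * f z := by
  rw [complexGaussian, integral_withDensity_eq_integral_smul measurable_gaussianDensity]
  rfl

theorem integrable_monomial_complexGaussian (a b : ℕ) :
    Integrable (fun z : ℂ => z ^ a * star z ^ b) complexGaussian := by
  rw [complexGaussian, integrable_withDensity_iff_integrable_smul measurable_gaussianDensity]
  refine (integrable_norm_pow_mul_gaussianDensity (a + b)).mono'
    (measurable_gaussianDensity.aestronglyMeasurable.smul
      (by fun_prop : Continuous fun z : ℂ => z ^ a * star z ^ b).aestronglyMeasurable)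
    (Filter.Eventually.of_forall fun z => ?_)
  rw [NNReal.smul_def, norm_smul, norm_mul, norm_pow, norm_pow, norm_star, ← pow_add, mul_comm,
    Real.norm_of_nonneg (NNReal.coe_nonneg _)]

theorem integral_monomial_complexGaussian (a b : ℕ) :
    ∫ z : ℂ, z ^ a * star z ^ b ∂complexGaussian = if a = b then (a.factorial : ℂ) else 0 := by
  rw [integral_complexGaussian]
  split_ifs with hab
  · subst hab
    have h : ∀ z : ℂ, ((gaussianDensity z : ℝ) : ℂ) * (z ^ a * star z ^ a) =
        ((‖z‖ ^ (2 * a) * (gaussianDensity z : ℝ) : ℝ) : ℂ) := by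
      intro z
      rw [← mul_pow, Complex.star_def, Complex.mul_conj, Complex.normSq_eq_norm_sq, pow_mul]
      push_cast
      ring
    simp only [h]
    rw [integral_complex_ofReal, integral_norm_pow_mul_gaussianDensity]
    have h' : (((2 * a : ℕ) : ℝ) + 2) / 2 = a + 1 := by
      push_cast
      ring
    rw [h', Real.Gamma_nat_eq_factorial, Complex.ofReal_natCast]
  · have hne : (a : ℝ) - b ≠ 0 := sub_ne_zero.2 (Nat.cast_injective.ne hab)
    -- Rotation by this angle preserves the measure and multiplies the integrand by `exp(iθ(a - b))
    -- = -1`, so the integral equals its own negative.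
    let θ : ℝ := Real.pi / (a - b)
    let ω : Circle := Circle.exp θ
    have hω : (ω : ℂ) ^ a * star (ω : ℂ) ^ b = -1 := by
      rw [Circle.coe_exp, Complex.star_def, ← Complex.exp_conj, ← Complex.exp_nat_mul,
        ← Complex.exp_nat_mul, ← Complex.exp_add, ← Complex.exp_pi_mul_I]
      congr 1
      have hne' : (a : ℂ) - b ≠ 0 := by exact_mod_cast hne
      simp only [θ, map_mul, Complex.conj_ofReal, Complex.conj_I]
      push_cast
      field_simp
      ring
    have h := (rotation ω).measurePreserving.integral_comp'
      (f := (rotation ω).toHomeomorph.toMeasurableEquiv)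
      fun z => ((gaussianDensity z : ℝ) : ℂ) * (z ^ a * star z ^ b)
    have h' : ∀ z : ℂ, ((gaussianDensity (ω * z) : ℝ) : ℂ) * ((ω * z) ^ a * star (ω * z) ^ b) =
        -1 * (((gaussianDensity z : ℝ) : ℂ) * (z ^ a * star z ^ b)) := by
      intro z
      rw [← hω, gaussianDensity, gaussianDensity, norm_mul, Circle.norm_coe, one_mul, star_mul',
        mul_pow, mul_pow]
      ring
    change ∫ z : ℂ, ((gaussianDensity (ω * z) : ℝ) : ℂ) * ((ω * z) ^ a * star (ω * z) ^ b) = _ at h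
    simp only [h'] at h
    rw [integral_const_mul] at h
    linear_combination (-1 / 2 : ℂ) * h

variable {D ι : Type*} [Fintype D] [DecidableEq D] [Fintype ι]

/-- The product of standard complex Gaussian distributions. -/
noncomputable def complexGaussianPi (D : Type*) [Fintype D] : Measure (D → ℂ) :=
  Measure.pi fun _ => complexGaussian

instance isProbabilityMeasure_complexGaussianPi : IsProbabilityMeasure (complexGaussianPi D) := by
  unfold complexGaussianPi
  infer_instance

theorem prod_apply_eq_prod_pow {M : Type*} [CommMonoid M] (u : ι → D) (z : D → M) :
    ∏ j, z (u j) = ∏ i, z i ^ Fintype.card {j // u j = i} := by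
  rw [← Fintype.prod_fiberwise' u z]
  simp

theorem prod_mul_prod_star_eq (u v : ι → D) (z : D → ℂ) :
    (∏ j, z (u j)) * ∏ j, star (z (v j)) = ∏ i, z i ^ Fintype.card {j // u j = i} *
      star (z i) ^ Fintype.card {j // v j = i} := by
  rw [prod_apply_eq_prod_pow u z, prod_apply_eq_prod_pow v fun i => star (z i),
    Finset.prod_mul_distrib]

theorem integrable_complexGaussianPi (u v : ι → D) :
    Integrable (fun z : D → ℂ => (∏ j, z (u j)) * ∏ j, star (z (v j))) (complexGaussianPi D) := by
  simp only [prod_mul_prod_star_eq u v]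
  exact Integrable.fintype_prod (f := fun i (z : ℂ) => z ^ Fintype.card {j // u j = i} *
    star z ^ Fintype.card {j // v j = i}) fun i => integrable_monomial_complexGaussian _ _

variable [DecidableEq ι]

/-- When the fibres of `u` and `v` have equal sizes, the permutations counted form a coset of the
stabilizer of `u`; otherwise there are none. -/
theorem sum_perm_ite_comp_eq (u v : ι → D) :
    (∑ π : Equiv.Perm ι, if v ∘ π = u then (1 : ℂ) else 0) =
      ∏ i, if Fintype.card {j // u j = i} = Fintype.card {j // v j = i} then
        ((Fintype.card {j // u j = i}).factorial : ℂ) else 0 := by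
  by_cases h : ∀ i, Fintype.card {j // u j = i} = Fintype.card {j // v j = i}
  · let e : Equiv.Perm ι := Equiv.ofFiberEquiv fun i => Fintype.equivOfCardEq (h i)
    have he : v ∘ e = u := funext fun j => Equiv.ofFiberEquiv_map _ j
    have h₁ := DomMulAct.stabilizer_card u
    rw [Fintype.card_subtype] at h₁
    simp only [h, if_true]
    rw [← Equiv.sum_comp (Equiv.mulLeft e)]
    have h₂ : ∀ π : Equiv.Perm ι, v ∘ (Equiv.mulLeft e π) = u ∘ π := fun π => by
      rw [← he]
      rfl
    simp only [h₂]
    rw [Finset.sum_boole, h₁]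
    simp [h]
  · push Not at h
    obtain ⟨i, hi⟩ := h
    rw [Finset.prod_eq_zero (Finset.mem_univ i) (if_neg hi)]
    refine Finset.sum_eq_zero fun π _ => if_neg fun hπ => hi ?_
    refine Fintype.card_congr (π.subtypeEquiv fun j => ?_)
    rw [← hπ]
    rfl

/-- Wick's formula for complex Gaussian moments. -/
theorem integral_complexGaussianPi (u v : ι → D) :
    ∫ z : D → ℂ, (∏ j, z (u j)) * ∏ j, star (z (v j)) ∂complexGaussianPi D =
      ∑ π : Equiv.Perm ι, if v ∘ π = u then (1 : ℂ) else 0 := by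
  simp only [prod_mul_prod_star_eq u v]
  rw [complexGaussianPi, integral_fintype_prod_eq_prod (𝕜 := ℂ)
    (fun i (z : ℂ) => z ^ Fintype.card {j // u j = i} * star z ^ Fintype.card {j // v j = i}),
    sum_perm_ite_comp_eq]
  exact Finset.prod_congr rfl fun i _ => integral_monomial_complexGaussian _ _

end GaussianMoments

/-! ### Gaussian averages of symmetric tensors. -/

section SymmetricTensors

open MeasureTheory

variable {D : Type*} {k : ℕ}

/-- The Wick pairings of `k + 1` factors are sorted by the partner `o` of the extra factor `none`,
leaving a permutation `σ` of the other `k`. -/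
theorem elim_comp_decomposeOption_symm_eq_iff (x y : D) (w w' : Fin k → D)
    (o : Option (Fin k)) (σ : Equiv.Perm (Fin k)) :
    ((fun p : Option (Fin k) => p.elim y w) ∘ ⇑(Equiv.Perm.decomposeOption.symm (o, σ)) =
      fun p => p.elim x w') ↔
    o.elim y w = x ∧
      w' = (o.elim w fun i => Function.update w i y) ∘ σ := by
  have hdec : ∀ p, Equiv.Perm.decomposeOption.symm (o, σ) p = Equiv.swap none o (p.map σ) :=
    fun p => rfl
  rw [funext_iff, Option.forall]
  simp only [Function.comp_apply, hdec, Option.map_none, Option.map_some, Equiv.swap_apply_left,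
    Option.elim_none, Option.elim_some]
  refine and_congr ?_ ?_
  · cases o <;> exact Iff.rfl
  · rw [funext_iff]
    refine forall_congr' fun j => ?_
    rw [@eq_comm _ (w' j)]
    cases o with
    | none => simp
    | some i =>
      simp only [Option.elim_some, Function.comp_apply, Function.update_apply]
      by_cases hij : σ j = i
      · simp [hij]
      · rw [Equiv.swap_apply_of_ne_of_ne (by simp) (by simpa using hij)]
        simp [hij]

variable [Fintype D]

/-- The polynomial on `ℂ^D` in the conjugate variables with coefficient tensor `Γ`. -/
noncomputable def conjPolynomial (Γ : (Fin k → D) → ℂ) (z : D → ℂ) : ℂ :=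
  ∑ w, Γ w * ∏ j, star (z (w j))

theorem conjPolynomial_mul_star_mul (Γ Γ' : (Fin k → D) → ℂ) (x y : D) (z : D → ℂ) :
    conjPolynomial Γ z * star (conjPolynomial Γ' z) * (z x * star (z y)) =
      ∑ w, ∑ w', (Γ w * star (Γ' w')) *
        ((∏ p : Option (Fin k), z (p.elim x w')) *
          ∏ p : Option (Fin k), star (z (p.elim y w))) := by
  simp only [conjPolynomial, star_sum, star_mul', star_prod, star_star, Finset.sum_mul,
    Finset.mul_sum, Fintype.prod_option, Option.elim_none, Option.elim_some]
  rw [Finset.sum_comm]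
  refine Finset.sum_congr rfl fun w _ => Finset.sum_congr rfl fun w' _ => ?_
  ring

variable [DecidableEq D]

theorem integrable_conjPolynomial_mul_star_mul (Γ Γ' : (Fin k → D) → ℂ) (x y : D) :
    Integrable (fun z => conjPolynomial Γ z * star (conjPolynomial Γ' z) * (z x * star (z y)))
      (complexGaussianPi D) := by
  simp only [conjPolynomial_mul_star_mul]
  exact integrable_finsetSum _ fun w _ => integrable_finsetSum _ fun w' _ =>
    (integrable_complexGaussianPi (fun p : Option (Fin k) => p.elim x w')
      (fun p : Option (Fin k) => p.elim y w)).const_mul _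

/-- If `z x` pairs with `star (z y)`, the two tensors are fully contracted; if it pairs with the
`i`-th tensor factor, that factor is left open. The symmetry of `Γ'` makes the remaining `k!`
pairings equal. -/
theorem integral_conjPolynomial_mul_star_mul {Γ Γ' : (Fin k → D) → ℂ}
    (hΓ' : ∀ (π : Equiv.Perm (Fin k)) w, Γ' (w ∘ π) = Γ' w) (x y : D) :
    ∫ z, conjPolynomial Γ z * star (conjPolynomial Γ' z) * (z x * star (z y))
      ∂complexGaussianPi D = k.factorial * ((if y = x then ∑ w, Γ w * star (Γ' w) else 0) +
        ∑ i, ∑ w, if w i = x then Γ w * star (Γ' (Function.update w i y)) else 0) := by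
  have hint : ∀ w w' : Fin k → D, Integrable (fun z : D → ℂ => (Γ w * star (Γ' w')) *
      ((∏ p : Option (Fin k), z (p.elim x w')) *
        ∏ p : Option (Fin k), star (z (p.elim y w)))) (complexGaussianPi D) := fun w w' =>
    (integrable_complexGaussianPi (fun p : Option (Fin k) => p.elim x w')
      (fun p : Option (Fin k) => p.elim y w)).const_mul _
  have hmoment : ∀ w w' : Fin k → D, ∫ z : D → ℂ, (Γ w * star (Γ' w')) *
      ((∏ p : Option (Fin k), z (p.elim x w')) * ∏ p : Option (Fin k), star (z (p.elim y w)))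
        ∂complexGaussianPi D = ∑ o : Option (Fin k), ∑ σ : Equiv.Perm (Fin k),
          if o.elim y w = x ∧
            w' = (o.elim w fun i => Function.update w i y) ∘ σ
          then Γ w * star (Γ' w') else 0 := by
    intro w w'
    rw [integral_const_mul, integral_complexGaussianPi (fun p : Option (Fin k) => p.elim x w')
      (fun p : Option (Fin k) => p.elim y w), ← Equiv.sum_comp Equiv.Perm.decomposeOption.symm,
      Fintype.sum_prod_type, Finset.mul_sum]
    refine Finset.sum_congr rfl fun o _ => ?_
    rw [Finset.mul_sum]
    refine Finset.sum_congr rfl fun σ _ => ?_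
    rw [mul_ite, mul_one, mul_zero]
    exact if_congr (elim_comp_decomposeOption_symm_eq_iff x y w w' o σ) rfl rfl
  simp only [conjPolynomial_mul_star_mul]
  rw [integral_finsetSum _ fun w _ => integrable_finsetSum _ fun w' _ => hint w w']
  have hsum : ∀ w, ∑ w', ∑ o : Option (Fin k), ∑ σ : Equiv.Perm (Fin k),
      (if o.elim y w = x ∧
        w' = (o.elim w fun i => Function.update w i y) ∘ σ
      then Γ w * star (Γ' w') else 0) = ∑ o : Option (Fin k), (k.factorial : ℂ) *
        if o.elim y w = x then
          Γ w * star (Γ' (o.elim w fun i => Function.update w i y)) else 0 := by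
    intro w
    rw [Finset.sum_comm]
    refine Finset.sum_congr rfl fun o _ => ?_
    rw [Finset.sum_comm]
    simp only [ite_and, Finset.sum_ite_irrel, Finset.sum_ite_eq',
      Finset.mem_univ, if_true, Finset.sum_const_zero, hΓ']
    simp [Fintype.card_perm]
  simp only [integral_finsetSum _ fun w' _ => hint _ w', hmoment, hsum]
  rw [Finset.sum_comm, Fintype.sum_option, mul_add, Finset.mul_sum]
  congr 1
  · rw [← Finset.mul_sum]
    by_cases h : y = x <;> simp [h]
  · exact Finset.sum_congr rfl fun i _ => (Finset.mul_sum _ _ _).symm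

theorem sum_ite_update_eq {Γ Γ' : (Fin k → D) → ℂ}
    (hΓ : ∀ (π : Equiv.Perm (Fin k)) w, Γ (w ∘ π) = Γ w)
    (hΓ' : ∀ (π : Equiv.Perm (Fin k)) w, Γ' (w ∘ π) = Γ' w) (x y : D) (i j : Fin k) :
    (∑ w, if w i = x then Γ w * star (Γ' (Function.update w i y)) else 0) =
      ∑ w, if w j = x then Γ w * star (Γ' (Function.update w j y)) else 0 := by
  rw [← Equiv.sum_comp ((Equiv.swap i j).arrowCongr (Equiv.refl D))]
  refine Finset.sum_congr rfl fun w _ => ?_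
  have h : (Equiv.swap i j).arrowCongr (Equiv.refl D) w = w ∘ Equiv.swap i j := rfl
  have h' : Function.update (w ∘ Equiv.swap i j) i y =
      Function.update w j y ∘ Equiv.swap i j := by
    rw [Function.update_comp_equiv, Equiv.symm_swap, Equiv.swap_apply_right]
  rw [h, h', hΓ, hΓ', Function.comp_apply, Equiv.swap_apply_left]

end SymmetricTensors

/-! ### Invariant square roots and the separable cone. -/

section Separable

open MeasureTheory

/-- Uniqueness of the positive square root passes the permutation symmetries of `σ` on to it. -/
theorem exists_posSemidef_sqrt {n : Type*} [Fintype n] [DecidableEq n] {σ : Matrix n n ℂ}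
    (hσ : σ.PosSemidef) : ∃ T : Matrix n n ℂ, T.IsHermitian ∧ T * T = σ ∧
      ∀ e : Equiv.Perm n, σ.submatrix e e = σ → T.submatrix e e = T := by
  open scoped MatrixOrder Matrix.Norms.L2Operator in
  refine ⟨CFC.sqrt σ, (CFC.sqrt_nonneg σ).isSelfAdjoint,
    CFC.sqrt_mul_sqrt_self σ hσ.nonneg, fun e he => ?_⟩
  refine (CFC.sqrt_unique ?_ ?_).symm
  · rw [Matrix.submatrix_mul_equiv, CFC.sqrt_mul_sqrt_self σ hσ.nonneg, he]
  · exact ((Matrix.nonneg_iff_posSemidef.1 (CFC.sqrt_nonneg σ)).submatrix e).nonneg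

variable {C E : Type*} [Fintype C] [Fintype E]

/-- Product density operators. -/
def productStates (C E : Type*) [Fintype C] [Fintype E] : Set (Matrix (C × E) (C × E) ℂ) :=
  Set.image2 (Matrix.kroneckerMap (· * ·)) {P : Matrix C C ℂ | IsDensityOperator P}
    {Q : Matrix E E ℂ | IsDensityOperator Q}

theorem isCompact_productStates (C E : Type*) [Fintype C] [Fintype E] :
    IsCompact (productStates C E) := by
  rw [productStates, ← Set.image_prod]
  refine (isCompact_setOf_isDensityOperator.prod isCompact_setOf_isDensityOperator).image ?_
  refine continuous_matrix fun p q => ?_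
  exact (continuous_fst.matrix_elem _ _).mul (continuous_snd.matrix_elem _ _)

/-- The real part of the trace, as a real-linear functional. -/
noncomputable def reTrace (n : Type*) [Fintype n] : Matrix n n ℂ →L[ℝ] ℝ where
  toFun X := X.trace.re
  map_add' X Y := by simp
  map_smul' c X := by simp [Matrix.trace_smul]
  cont := by fun_prop

/-- The cone of unnormalized separable states. -/
def separableCone (C E : Type*) [Fintype C] [Fintype E] : Set (Matrix (C × E) (C × E) ℂ) :=
  {X | 0 ≤ reTrace (C × E) X ∧
    ∃ S ∈ convexHull ℝ (productStates C E), reTrace (C × E) X • S = X}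

theorem isClosed_separableCone : IsClosed (separableCone C E) :=
  have : FirstCountableTopology (Matrix (C × E) (C × E) ℂ) :=
    inferInstanceAs (FirstCountableTopology (C × E → C × E → ℂ))
  isClosed_cone_of_isCompact (isCompact_productStates C E).convexHull_of_finiteDimensional _

theorem convex_separableCone : Convex ℝ (separableCone C E) :=
  convex_cone_of_convex (convex_convexHull ℝ _) (reTrace (C × E)).toLinearMap

theorem isDensityOperator_inv_smul {P : Matrix C C ℂ} (hP : P.PosSemidef)
    (h : P.trace.re ≠ 0) : IsDensityOperator ((P.trace.re)⁻¹ • P) := by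
  have h₀ := Complex.le_def.1 hP.trace_nonneg
  refine ⟨hP.smul (inv_nonneg.2 h₀.1), ?_⟩
  have h₁ : P.trace = (P.trace.re : ℂ) := Complex.ext rfl h₀.2.symm
  rw [Matrix.trace_smul, Complex.real_smul, ← mul_inv_cancel₀ (Complex.ofReal_ne_zero.2 h),
    Complex.ofReal_inv, mul_comm]
  nth_rewrite 1 [h₁]
  rfl

theorem exists_isDensityOperator (E : Type*) [Fintype E] [Nonempty E] :
    ∃ ρ : Matrix E E ℂ, IsDensityOperator ρ := by
  classical
  obtain ⟨a⟩ := ‹Nonempty E›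
  refine ⟨_, isDensityOperator_vecMulVec (ψ := Pi.single a 1) ?_⟩
  rw [Finset.sum_eq_single a] <;> simp +contextual

theorem kronecker_mem_separableCone [Nonempty C] [Nonempty E] {P : Matrix C C ℂ}
    {Q : Matrix E E ℂ} (hP : P.PosSemidef) (hQ : Q.PosSemidef) :
    Matrix.kroneckerMap (· * ·) P Q ∈ separableCone C E := by
  have hP₀ := Complex.le_def.1 hP.trace_nonneg
  have hQ₀ := Complex.le_def.1 hQ.trace_nonneg
  have htr : reTrace (C × E) (Matrix.kroneckerMap (· * ·) P Q) = P.trace.re * Q.trace.re := by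
    change (Matrix.kroneckerMap (· * ·) P Q).trace.re = _
    rw [Matrix.trace_kronecker, Complex.mul_re, ← hP₀.2]
    simp
  refine ⟨by rw [htr]; exact mul_nonneg hP₀.1 hQ₀.1, ?_⟩
  rw [htr]
  by_cases hp : P.trace.re = 0
  · have hP' : P = 0 := hP.trace_eq_zero_iff.1 (Complex.ext hp hP₀.2.symm)
    obtain ⟨ρ, hρ⟩ := exists_isDensityOperator C
    obtain ⟨ω, hω⟩ := exists_isDensityOperator E
    refine ⟨_, subset_convexHull ℝ _ ⟨ρ, hρ, ω, hω, rfl⟩, ?_⟩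
    rw [hp, zero_mul, zero_smul, hP']
    ext p q
    simp
  by_cases hq : Q.trace.re = 0
  · have hQ' : Q = 0 := hQ.trace_eq_zero_iff.1 (Complex.ext hq hQ₀.2.symm)
    obtain ⟨ρ, hρ⟩ := exists_isDensityOperator C
    obtain ⟨ω, hω⟩ := exists_isDensityOperator E
    refine ⟨_, subset_convexHull ℝ _ ⟨ρ, hρ, ω, hω, rfl⟩, ?_⟩
    rw [hq, mul_zero, zero_smul, hQ']
    ext p q
    simp
  refine ⟨_, subset_convexHull ℝ _ ⟨_, isDensityOperator_inv_smul hP hp, _,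
    isDensityOperator_inv_smul hQ hq, rfl⟩, ?_⟩
  ext p q
  have hp' := Complex.ofReal_ne_zero.2 hp
  have hq' := Complex.ofReal_ne_zero.2 hq
  simp only [Matrix.smul_apply, Matrix.kroneckerMap_apply, Complex.real_smul]
  push_cast
  field_simp

theorem exists_decomposition_of_smul_mem_separableCone {X : Matrix (C × E) (C × E) ℂ} {r : ℝ}
    (hr : 0 < r) (hX : r • X ∈ separableCone C E) :
    ∃ (n : ℕ) (P : Fin n → Matrix C C ℂ) (Q : Fin n → Matrix E E ℂ),
      (∀ y, (P y).PosSemidef) ∧ (∀ y, IsDensityOperator (Q y)) ∧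
        X = ∑ y, Matrix.kroneckerMap (· * ·) (P y) (Q y) := by
  obtain ⟨h₀, S, hS, hSX⟩ := hX
  rw [convexHull_eq_image_stdSimplex] at hS
  obtain ⟨⟨w, z⟩, ⟨hw, hz⟩, rfl⟩ := hS
  choose P hP Q hQ hPQ using fun i => hz i trivial
  set t := reTrace (C × E) (r • X)
  refine ⟨_, fun i => (r⁻¹ * (t * w i)) • P i, Q, fun i => (hP i).1.smul ?_, hQ, ?_⟩
  · exact mul_nonneg (inv_nonneg.2 hr.le) (mul_nonneg h₀ (hw.1 i))
  · have h : X = r⁻¹ • t • ∑ i, w i • z i := by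
      change X = r⁻¹ • t • (fun p : (Fin (Module.finrank ℝ (Matrix (C × E) (C × E) ℂ) + 1) → ℝ) ×
        (Fin (Module.finrank ℝ (Matrix (C × E) (C × E) ℂ) + 1) → Matrix (C × E) (C × E) ℂ) =>
          ∑ i, p.1 i • p.2 i) (w, z)
      rw [hSX, smul_smul, inv_mul_cancel₀ hr.ne', one_smul]
    rw [h, Finset.smul_sum, Finset.smul_sum]
    refine Finset.sum_congr rfl fun i _ => ?_
    rw [show z i = Matrix.kroneckerMap (· * ·) (P i) (Q i) from (hPQ i).symm]
    ext p q
    simp only [Matrix.smul_apply, Matrix.kroneckerMap_apply, Complex.real_smul]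
    push_cast
    ring

/-- A probability average stays in a closed convex set, which turns a continuous mixture into an
element with a finite decomposition. -/
theorem integral_mem_separableCone {Ω : Type*} [MeasurableSpace Ω] {μ : Measure Ω}
    [IsProbabilityMeasure μ] {F : Ω → Matrix (C × E) (C × E) ℂ}
    (hF : ∀ ω, F ω ∈ separableCone C E) (hint : ∀ p q, Integrable (fun ω => F ω p q) μ) :
    (Matrix.of fun p q => ∫ ω, F ω p q ∂μ) ∈ separableCone C E := by
  let S : Set (C × E → C × E → ℂ) := {X | Matrix.of X ∈ separableCone C E}
  let f : Ω → C × E → C × E → ℂ := fun ω p q => F ω p q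
  have hS : Convex ℝ S := fun X hX Y hY a b ha hb hab =>
    convex_separableCone hX hY ha hb hab
  have hSc : IsClosed S :=
    isClosed_separableCone.preimage (continuous_matrix fun p q => by
      exact (continuous_apply q).comp (continuous_apply p))
  have hf : Integrable f μ := Integrable.of_eval fun p => Integrable.of_eval fun q => hint p q
  have h := hS.integral_mem hSc (Filter.Eventually.of_forall hF) hf
  have heq : (Matrix.of fun p q => ∫ ω, F ω p q ∂μ) = Matrix.of (∫ ω, f ω ∂μ) := by
    ext p q
    rw [Matrix.of_apply, Matrix.of_apply, eval_integral fun p => hf.eval p,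
      eval_integral fun q => (hf.eval p).eval q]
  rw [heq]
  exact h

end Separable

/-! ### The finite de Finetti identity for symmetric operators. -/

section SymmetricExtension

open MeasureTheory

variable {C E : Type*} [Fintype C] [Fintype E] {k : ℕ}

theorem sum_arrow_prod {M : Type*} [AddCommMonoid M] (g : (Fin k → E) → (Fin k → E) → M) :
    ∑ w : Fin k → E × E, g (fun j => (w j).1) (fun j => (w j).2) = ∑ f, ∑ h, g f h := by
  classical
  rw [← Fintype.sum_prod_type']
  exact Equiv.sum_comp (Equiv.arrowProdEquivProdArrow (Fin k) (fun _ => E) (fun _ => E))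
    fun p => g p.1 p.2

/-- The purification of a symmetric operator on `C E^k`, as a family of tensors over `E × E`. -/
def purificationTensor (T : Matrix (C × (Fin k → E)) (C × (Fin k → E)) ℂ) (c e : C)
    (w : Fin k → E × E) : ℂ :=
  T (c, fun j => (w j).1) (e, fun j => (w j).2)

theorem sum_purificationTensor_mul_star [DecidableEq E]
    {T : Matrix (C × (Fin k → E)) (C × (Fin k → E)) ℂ} (hT : T.IsHermitian) (c c' : C) :
    ∑ e, ∑ w, purificationTensor T c e w * star (purificationTensor T c' e w) =
      ∑ f, (T * T) (c, f) (c', f) := by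
  have h : ∀ e, ∑ w, purificationTensor T c e w * star (purificationTensor T c' e w) =
      ∑ f, ∑ h, T (c, f) (e, h) * star (T (c', f) (e, h)) := fun e =>
    sum_arrow_prod fun f h : Fin k → E => T (c, f) (e, h) * star (T (c', f) (e, h))
  simp only [h, Matrix.mul_apply, Fintype.sum_prod_type, hT.apply]
  exact Finset.sum_comm

/-- Tracing out the purifying systems turns the open contraction of the tensor at slot `i` into the
one-copy marginal of `T²`. -/
theorem sum_ite_purificationTensor_update [DecidableEq E]
    {T : Matrix (C × (Fin k → E)) (C × (Fin k → E)) ℂ} (hT : T.IsHermitian) (c c' : C)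
    (x x' : E) (i : Fin k) :
    ∑ e, ∑ s, ∑ w, (if w i = (x, s) then purificationTensor T c e w *
      star (purificationTensor T c' e (Function.update w i (x', s))) else 0) =
        keepOneB i (T * T) (c, x) (c', x') := by
  have h₁ : ∀ e s w, (if w i = (x, s) then purificationTensor T c e w *
      star (purificationTensor T c' e (Function.update w i (x', s))) else 0) =
      if (w i).2 = s then (if (w i).1 = x then T (c, fun j => (w j).1) (e, fun j => (w j).2) *
        star (T (c', Function.update (fun j => (w j).1) i x') (e, fun j => (w j).2)) else 0)
      else 0 := by
    intro e s w
    by_cases hx : (w i).1 = x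
    · by_cases hs : (w i).2 = s
      · have hw : w i = (x, s) := Prod.ext hx hs
        have hfst : (fun j => (Function.update w i (x', s) j).1) =
            Function.update (fun j => (w j).1) i x' := by
          funext j
          by_cases hj : j = i
          · subst hj
            simp
          · simp [hj]
        have hsnd : (fun j => (Function.update w i (x', s) j).2) = fun j => (w j).2 := by
          funext j
          by_cases hj : j = i
          · subst hj
            simp [hs]
          · simp [hj]
        rw [if_pos hw, if_pos hs, if_pos hx]
        simp only [purificationTensor, hfst, hsnd]
      · rw [if_neg hs, if_neg fun h => hs (congrArg Prod.snd h)]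
    · rw [if_neg hx, if_neg fun h => hx (congrArg Prod.fst h), ite_self]
  have h₂ : ∀ e, ∑ s, ∑ w, (if w i = (x, s) then purificationTensor T c e w *
      star (purificationTensor T c' e (Function.update w i (x', s))) else 0) =
      ∑ f, ∑ h, if f i = x then T (c, f) (e, h) * star (T (c', Function.update f i x') (e, h))
        else 0 := by
    intro e
    simp only [h₁]
    rw [Finset.sum_comm]
    simp only [Finset.sum_ite_eq, Finset.mem_univ, if_true]
    exact sum_arrow_prod fun f h : Fin k → E => if f i = x then
      T (c, f) (e, h) * star (T (c', Function.update f i x') (e, h)) else 0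
  simp only [h₂, keepOneB, Matrix.of_apply, Matrix.mul_apply, Fintype.sum_prod_type, hT.apply]
  rw [Finset.sum_comm]
  simp only [Finset.sum_ite_irrel, Finset.sum_const_zero]

theorem exists_separable_decomposition_of_symmetric [DecidableEq E] [Nonempty C] [Nonempty E]
    (hk : 0 < k) {σ : Matrix (C × (Fin k → E)) (C × (Fin k → E)) ℂ} (hσ : σ.PosSemidef)
    (hsymm : ∀ π : Equiv.Perm (Fin k), permuteB π σ = σ) :
    ∃ (n : ℕ) (P : Fin n → Matrix C C ℂ) (Q : Fin n → Matrix E E ℂ),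
      (∀ y, (P y).PosSemidef) ∧ (∀ y, IsDensityOperator (Q y)) ∧
        ∀ c c' x x', ∑ y, P y c c' * Q y x x' =
          k * keepOneB ⟨0, hk⟩ σ (c, x) (c', x') +
            if x' = x then Fintype.card E * ∑ f, σ (c, f) (c', f) else 0 := by
  classical
  obtain ⟨T, hT, hTσ, hTsymm⟩ := exists_posSemidef_sqrt hσ
  have hΓ : ∀ (c e : C) (π : Equiv.Perm (Fin k)) w,
      purificationTensor T c e (w ∘ π) = purificationTensor T c e w := by
    intro c e π w
    have h := hTsymm (Equiv.prodCongr (Equiv.refl C) (π.symm.arrowCongr (Equiv.refl E)))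
      (hsymm π)
    exact congrFun (congrFun h (c, fun j => (w j).1)) (e, fun j => (w j).2)
  -- `N z` is the overlap of the purification with `z^{⊗k}`, and `Z z * (Z z)†` is the reduced
  -- operator of `|z⟩⟨z|` on the first copy of `E`.
  let N : (E × E → ℂ) → Matrix C C ℂ := fun z =>
    Matrix.of fun c e => conjPolynomial (purificationTensor T c e) z
  let Z : (E × E → ℂ) → Matrix E E ℂ := fun z => Matrix.of fun x s => z (x, s)
  let F : (E × E → ℂ) → Matrix (C × E) (C × E) ℂ := fun z =>
    Matrix.kroneckerMap (· * ·) (N z * (N z).conjTranspose) (Z z * (Z z).conjTranspose)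
  have hF : ∀ z, F z ∈ separableCone C E := fun z => kronecker_mem_separableCone
    (Matrix.posSemidef_self_mul_conjTranspose _) (Matrix.posSemidef_self_mul_conjTranspose _)
  have hFapply : ∀ z p q, F z p q = ∑ e, ∑ s,
      conjPolynomial (purificationTensor T p.1 e) z *
        star (conjPolynomial (purificationTensor T q.1 e) z) * (z (p.2, s) * star (z (q.2, s))) := by
    intro z p q
    simp only [F, Matrix.kroneckerMap_apply, Matrix.mul_apply, Matrix.conjTranspose_apply, N, Z,
      Matrix.of_apply, Finset.sum_mul, Finset.mul_sum]
    exact Finset.sum_comm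
  have hint : ∀ p q, Integrable (fun z => F z p q) (complexGaussianPi (E × E)) := by
    intro p q
    simp only [hFapply]
    exact integrable_finsetSum _ fun e _ => integrable_finsetSum _ fun s _ =>
      integrable_conjPolynomial_mul_star_mul _ _ _ _
  let X : Matrix (C × E) (C × E) ℂ := Matrix.of fun p q =>
    k * keepOneB ⟨0, hk⟩ σ p q +
      if q.2 = p.2 then Fintype.card E * ∑ f, σ (p.1, f) (q.1, f) else 0
  have hX : (k.factorial : ℝ) • X =
      Matrix.of fun p q => ∫ z, F z p q ∂complexGaussianPi (E × E) := by
    ext ⟨c, x⟩ ⟨c', x'⟩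
    -- By symmetry all `k` slots contribute equally, which produces the coefficient `k`.
    have hcop : ∀ e s, ∑ i, ∑ w, (if w i = (x, s) then purificationTensor T c e w *
        star (purificationTensor T c' e (Function.update w i (x', s))) else 0) =
        k * ∑ w, (if w ⟨0, hk⟩ = (x, s) then purificationTensor T c e w *
          star (purificationTensor T c' e (Function.update w ⟨0, hk⟩ (x', s))) else 0) := by
      intro e s
      rw [Finset.sum_congr rfl fun i _ => sum_ite_update_eq (hΓ c e) (hΓ c' e) _ _ i ⟨0, hk⟩]
      simp
    have hmoment : ∀ e s, ∫ z, conjPolynomial (purificationTensor T c e) z *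
        star (conjPolynomial (purificationTensor T c' e) z) * (z (x, s) * star (z (x', s)))
          ∂complexGaussianPi (E × E) = k.factorial * ((if x' = x then
            ∑ w, purificationTensor T c e w * star (purificationTensor T c' e w) else 0) +
          k * ∑ w, (if w ⟨0, hk⟩ = (x, s) then purificationTensor T c e w *
            star (purificationTensor T c' e (Function.update w ⟨0, hk⟩ (x', s))) else 0)) := by
      intro e s
      rw [integral_conjPolynomial_mul_star_mul (hΓ c' e), hcop]
      simp only [Prod.mk.injEq, and_true]
    -- The fully contracted term does not depend on `s`, whence the factor `|E|`.
    have hsum : ∑ e, ∑ _s : E, (if x' = x then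
        ∑ w, purificationTensor T c e w * star (purificationTensor T c' e w) else 0) =
        if x' = x then Fintype.card E * ∑ f, σ (c, f) (c', f) else 0 := by
      split_ifs
      · simp only [Finset.sum_const, Finset.card_univ, nsmul_eq_mul, ← Finset.mul_sum]
        rw [sum_purificationTensor_mul_star hT, hTσ]
      · simp
    simp only [Matrix.of_apply, hFapply]
    rw [integral_finsetSum _ fun e _ => integrable_finsetSum _ fun s _ =>
      integrable_conjPolynomial_mul_star_mul _ _ _ _, Finset.sum_congr rfl fun e _ =>
      (integral_finsetSum _ fun s _ => integrable_conjPolynomial_mul_star_mul _ _ _ _).trans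
        (Finset.sum_congr rfl fun s _ => hmoment e s)]
    simp only [← Finset.mul_sum, Finset.sum_add_distrib]
    rw [hsum, sum_ite_purificationTensor_update hT, hTσ, add_comm, Matrix.smul_apply,
      Complex.real_smul, Complex.ofReal_natCast]
    rfl
  have hmem := integral_mem_separableCone hF hint
  rw [← hX] at hmem
  obtain ⟨n, P, Q, hP, hQ, hPQ⟩ :=
    exists_decomposition_of_smul_mem_separableCone (by positivity) hmem
  refine ⟨n, P, Q, hP, hQ, fun c c' x x' => ?_⟩
  have h := congrFun (congrFun hPQ (c, x)) (c', x')
  simp only [Matrix.sum_apply, Matrix.kroneckerMap_apply, X, Matrix.of_apply] at h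
  exact h.symm

end SymmetricExtension

/-! ### From extendible channels to measure-and-prepare channels. -/

section KExtendible

/-- Positive matrices span, so conditions imposed on states hold for all operators, in particular
for the matrix units defining Choi matrices. -/
theorem linearMap_ext_of_isDensityOperator {A V : Type*} [Fintype A] [AddCommGroup V] [Module ℂ V]
    {f g : Matrix A A ℂ →ₗ[ℂ] V} (h : ∀ ρ, IsDensityOperator ρ → f ρ = g ρ) : f = g := by
  classical
  open scoped MatrixOrder Matrix.Norms.L2Operator in
  refine LinearMap.ext_on (CStarAlgebra.span_nonneg (A := Matrix A A ℂ)) fun X hX => ?_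
  have hX' : X.PosSemidef := Matrix.nonneg_iff_posSemidef.1 hX
  by_cases ht : X.trace.re = 0
  · rw [hX'.trace_eq_zero_iff.1 (Complex.ext ht (Complex.le_def.1 hX'.trace_nonneg).2.symm),
      map_zero, map_zero]
  · have h₁ := h _ (isDensityOperator_inv_smul hX' ht)
    have h₂ : (X.trace.re : ℂ) • ((X.trace.re)⁻¹ • X) = X := by
      ext i j
      simp only [Matrix.smul_apply, Complex.real_smul, smul_eq_mul, Complex.ofReal_inv]
      exact mul_inv_cancel_left₀ (Complex.ofReal_ne_zero.2 ht) _
    rw [← h₂, f.map_smul (X.trace.re : ℂ), g.map_smul (X.trace.re : ℂ), h₁]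

variable {C C' : Type*} [Fintype C] [Fintype C'] [DecidableEq C'] {k : ℕ}

theorem IsKExtendibleMessage.isQuantumChannel {𝒜 : Superop C C'}
    (h𝒜 : IsKExtendibleMessage k 𝒜) : IsQuantumChannel 𝒜 :=
  (IsQuantumChannel.relabel (Equiv.punitProd C')).comp
    (h𝒜.1.comp (IsQuantumChannel.relabel (Equiv.prodPUnit C).symm))

/-- `keepOneB` as a linear map. -/
def keepOneBLinearMap (A B : Type*) [Fintype B] [DecidableEq B] (i : Fin k) :
    Superop (A × (Fin k → B)) (A × B) where
  toFun := keepOneB i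
  map_add' X Y := by
    ext p q
    simp only [keepOneB, Matrix.of_apply, Matrix.add_apply, ← Finset.sum_add_distrib]
    exact Finset.sum_congr rfl fun f _ => by split_ifs <;> simp
  map_smul' c X := by
    ext p q
    simp [keepOneB, Finset.mul_sum]

/-- `permuteB` as a linear map. -/
def permuteBLinearMap (A B : Type*) (π : Equiv.Perm (Fin k)) :
    Superop (A × (Fin k → B)) (A × (Fin k → B)) where
  toFun := permuteB π
  map_add' _ _ := rfl
  map_smul' _ _ := rfl

/-- Bob's inputs are trivial, so permutations act on the outputs alone and covariance of the
extension becomes invariance of its Choi matrix. -/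
theorem IsKExtendibleMessage.exists_symmetric_choi {𝒜 : Superop C C'} [DecidableEq C]
    (h𝒜 : IsKExtendibleMessage k 𝒜) :
    ∃ (hk : 0 < k) (σ : Matrix (C × (Fin k → C')) (C × (Fin k → C')) ℂ), σ.PosSemidef ∧
      (∀ π : Equiv.Perm (Fin k), permuteB π σ = σ) ∧
      (∀ c c', ∑ f, σ (c, f) (c', f) = if c = c' then 1 else 0) ∧
      keepOneB ⟨0, hk⟩ σ = choi 𝒜 := by
  obtain ⟨-, hk, M, hM, hcov, hmarg⟩ := h𝒜
  let θ : C → C → Matrix (C × (Fin k → Unit)) (C × (Fin k → Unit)) ℂ := fun c c' =>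
    Matrix.single (c, fun _ => ()) (c', fun _ => ()) 1
  have hcov' : ∀ π, M ∘ₗ permuteBLinearMap C Unit π = permuteBLinearMap Unit C' π ∘ₗ M :=
    fun π => linearMap_ext_of_isDensityOperator (hcov π)
  have hmarg' : asBipartite 𝒜 ∘ₗ keepOneBLinearMap C Unit ⟨0, hk⟩ =
      keepOneBLinearMap Unit C' ⟨0, hk⟩ ∘ₗ M := linearMap_ext_of_isDensityOperator hmarg
  refine ⟨hk, Matrix.of fun p q => M (θ p.1 q.1) ((), p.2) ((), q.2), ?_, fun π => ?_,
    fun c c' => ?_, ?_⟩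
  · exact hM.1.posSemidef_choi.submatrix fun p : C × (Fin k → C') =>
      ((p.1, fun _ => ()), ((), p.2))
  · ext p q
    have h := LinearMap.congr_fun (hcov' π) (θ p.1 q.1)
    have hθ : permuteBLinearMap C Unit π (θ p.1 q.1) = θ p.1 q.1 := rfl
    rw [LinearMap.comp_apply, hθ] at h
    exact (congrFun (congrFun h ((), p.2)) ((), q.2)).symm
  · have h := hM.2 (θ c c')
    rw [Matrix.trace, Fintype.sum_prod_type, Fintype.sum_unique] at h
    refine h.trans ?_
    by_cases hc : c = c'
    · subst hc
      rw [if_pos rfl]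
      exact Matrix.trace_single_eq_same _ _
    · rw [if_neg hc]
      exact Matrix.trace_single_eq_of_ne _ _ _ fun h => hc (congrArg Prod.fst h)
  · ext ⟨c, x⟩ ⟨c', x'⟩
    have h := LinearMap.congr_fun hmarg' (θ c c')
    have hθ : keepOneBLinearMap C Unit ⟨0, hk⟩ (θ c c') = Matrix.single (c, ()) (c', ()) 1 := by
      ext ⟨a, u⟩ ⟨a', u'⟩
      change (∑ f : Fin k → Unit, _) = _
      rw [Fintype.sum_unique]
      simp [θ, Matrix.single_apply]
    have hs : relabel (Equiv.prodPUnit C) (Matrix.single (c, ()) (c', ()) 1) =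
        Matrix.single c c' 1 := by
      ext a a'
      simp [relabel_apply, Matrix.single_apply]
    rw [LinearMap.comp_apply, hθ, asBipartite, LinearMap.comp_apply, LinearMap.comp_apply] at h
    have h' := congrFun (congrFun h ((), x)) ((), x')
    rw [relabel_apply] at h'
    erw [hs] at h'
    exact h'.symm

/-- The completely depolarizing channel. -/
noncomputable def depolarizing (C C' : Type*) [Fintype C] [DecidableEq C] [Fintype C']
    [DecidableEq C'] : Superop C C' :=
  measurePrepare 1 ((Fintype.card C' : ℝ)⁻¹ • 1)

theorem isQuantumChannel_depolarizing (C C' : Type*) [Fintype C] [DecidableEq C] [Fintype C']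
    [DecidableEq C'] [Nonempty C'] : IsQuantumChannel (depolarizing C C') := by
  refine isQuantumChannel_measurePrepare_one ⟨Matrix.PosSemidef.one.smul (by positivity), ?_⟩
  rw [Matrix.trace_smul, Matrix.trace_one, Complex.real_smul]
  push_cast
  exact inv_mul_cancel₀ (by simp)

theorem choi_injective {A B : Type*} [Fintype A] [DecidableEq A] :
    Function.Injective (choi : Superop A B → Matrix (A × B) (A × B) ℂ) := fun Φ Ψ h => by
  rw [← ofChoi_choi Φ, h, ofChoi_choi]

/-- A measure-and-prepare form of the finite de Finetti theorem for extendible channels. -/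
theorem IsKExtendibleMessage.exists_sum_measurePrepare [DecidableEq C] [Nonempty C] [Nonempty C']
    {𝒜 : Superop C C'} (h𝒜 : IsKExtendibleMessage k 𝒜) :
    ∃ (n : ℕ) (P : Fin n → Matrix C C ℂ) (Q : Fin n → Matrix C' C' ℂ),
      (∀ y, (P y).PosSemidef) ∧ (∀ y, IsDensityOperator (Q y)) ∧
        ∑ y, measurePrepare (P y) (Q y) =
          (k : ℂ) • 𝒜 + (Fintype.card C' : ℂ) ^ 2 • depolarizing C C' := by
  obtain ⟨hk, σ, hσ, hsymm, htr, hmarg⟩ := h𝒜.exists_symmetric_choi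
  obtain ⟨n, P, Q, hP, hQ, hPQ⟩ := exists_separable_decomposition_of_symmetric hk hσ hsymm
  refine ⟨n, P, Q, hP, hQ, choi_injective ?_⟩
  ext ⟨c, x⟩ ⟨c', x'⟩
  have hd : (Fintype.card C' : ℂ) ≠ 0 := by simp
  have h := hPQ c c' x x'
  rw [hmarg, htr] at h
  rw [choi_sum, Matrix.sum_apply]
  have hsum : ∀ y, choi (measurePrepare (P y) (Q y)) (c, x) (c', x') = P y c c' * Q y x x' :=
    fun y => by rw [measurePrepare, choi_ofChoi, Matrix.kroneckerMap_apply]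
  have hdep : choi (depolarizing C C') (c, x) (c', x') =
      (if c = c' then 1 else 0) * ((Fintype.card C' : ℂ)⁻¹ * if x = x' then 1 else 0) := by
    rw [depolarizing, measurePrepare, choi_ofChoi, Matrix.kroneckerMap_apply, Matrix.one_apply,
      Matrix.smul_apply, Matrix.one_apply, Complex.real_smul]
    push_cast
    rfl
  simp only [hsum]
  rw [h]
  change _ = k * choi 𝒜 (c, x) (c', x') +
    (Fintype.card C' : ℂ) ^ 2 * choi (depolarizing C C') (c, x) (c', x')
  rw [hdep]
  -- The Choi matrix of the depolarizing channel is `1 ⊗ 1 / d`, so `d (1 ⊗ 1)` is `d²` times it.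
  congr 1
  by_cases hx : x = x'
  · rw [if_pos hx.symm, if_pos hx]
    field_simp
  · rw [if_neg fun h => hx h.symm, if_neg hx]
    ring

end KExtendible

/-! ### Message protocols and the quantitative bound. -/

section MessageProtocol

variable {A B A' B' C C' : Type*}

theorem IsQuantumChannel.messageProtocol [Fintype A] [Fintype B] [Fintype A'] [Fintype B']
    [Fintype C] [Fintype C'] {ℰ : Superop A (A' × C)} {𝒜 : Superop C C'}
    {𝒟 : Superop (C' × B) B'} (hℰ : IsQuantumChannel ℰ) (h𝒜 : IsQuantumChannel 𝒜)
    (h𝒟 : IsQuantumChannel 𝒟) : IsQuantumChannel (messageProtocol ℰ 𝒜 𝒟) :=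
  h𝒟.idTensor.comp ((IsQuantumChannel.relabel _).comp
    (h𝒜.idTensor.tensorId.comp hℰ.tensorId))

/-- `messageProtocol` as a linear map in the channel carrying the message. -/
def messageProtocolLinearMap (ℰ : Superop A (A' × C)) (𝒟 : Superop (C' × B) B') :
    Superop C C' →ₗ[ℂ] Superop (A × B) (A' × B') where
  toFun 𝒜 := messageProtocol ℰ 𝒜 𝒟
  map_add' 𝒜 ℬ := by
    have h : tensorId (idTensor A' (𝒜 + ℬ)) B =
      tensorId (idTensor A' 𝒜) B + tensorId (idTensor A' ℬ) B := rfl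
    simp only [messageProtocol, h, LinearMap.add_comp, LinearMap.comp_add]
  map_smul' c 𝒜 := by
    have h : tensorId (idTensor A' (c • 𝒜)) B = c • tensorId (idTensor A' 𝒜) B := rfl
    simp only [messageProtocol, h, LinearMap.smul_comp, LinearMap.comp_smul, RingHom.id_apply]

/-- Alice's operation in a message protocol when the effect `P` is measured on the message. -/
def measureMessage [Fintype C] (ℰ : Superop A (A' × C)) (P : Matrix C C ℂ) : Superop A A' :=
  relabel (Equiv.prodPUnit A') ∘ₗ
    idTensor A' (measurePrepare P (1 : Matrix Unit Unit ℂ)) ∘ₗ ℰ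

theorem messageProtocol_measurePrepare [Fintype A] [DecidableEq A] [Fintype B] [DecidableEq B]
    [Fintype C] (ℰ : Superop A (A' × C)) (P : Matrix C C ℂ) (Q : Matrix C' C' ℂ)
    (𝒟 : Superop (C' × B) B') :
    messageProtocol ℰ (measurePrepare P Q) 𝒟 =
      tensorMap (measureMessage ℰ P) (𝒟 ∘ₗ prepare Q B) := by
  rw [tensorMap_eq_comp]
  refine LinearMap.ext fun X => ?_
  ext p q
  refine congrFun (congrFun (congrArg 𝒟 ?_) p.2) q.2
  ext ⟨c, b⟩ ⟨c', b'⟩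
  let Y := ℰ (Matrix.of fun a a' => X (a, b) (a', b'))
  let Z : Matrix C C ℂ := Matrix.of fun c c' => Y (p.1, c) (q.1, c')
  change measurePrepare P Q Z c c' =
    Q c c' * measurePrepare P (1 : Matrix Unit Unit ℂ) Z () ()
  rw [measurePrepare_apply, measurePrepare_apply, Matrix.smul_apply, Matrix.smul_apply,
    Matrix.one_apply_eq, smul_eq_mul, smul_eq_mul, mul_one, mul_comm]

theorem isCompletelyPositive_measureMessage [Fintype A'] [Fintype C] {ℰ : Superop A (A' × C)}
    (hℰ : IsCompletelyPositive ℰ) {P : Matrix C C ℂ} (hP : P.PosSemidef) :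
    IsCompletelyPositive (measureMessage ℰ P) :=
  (IsCompletelyPositive.relabel _).comp
    ((isCompletelyPositive_measurePrepare hP .one).idTensor.comp hℰ)

theorem trace_measureMessage [Fintype A'] [Fintype C] [Fintype C'] (ℰ : Superop A (A' × C))
    (P : Matrix C C ℂ) {Q : Matrix C' C' ℂ} (hQ : Q.trace = 1) (X : Matrix A A ℂ) :
    (measureMessage ℰ P X).trace = (idTensor A' (measurePrepare P Q) (ℰ X)).trace := by
  rw [Matrix.trace, Matrix.trace, Fintype.sum_prod_type]
  refine Finset.sum_congr rfl fun a _ => ?_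
  let Z : Matrix C C ℂ := Matrix.of fun c c' => ℰ X (a, c) (a, c')
  change measurePrepare P (1 : Matrix Unit Unit ℂ) Z () () = (measurePrepare P Q Z).trace
  rw [measurePrepare_apply, measurePrepare_apply, Matrix.smul_apply, Matrix.one_apply_eq,
    Matrix.trace_smul, hQ]

/-- Alice measures her message and sends the outcome `y`; Bob prepares `Q y` and applies `𝒟`. Trace
preservation is needed only for the sum over outcomes. -/
theorem messageProtocol_mem_oneWayLOCC [Fintype A] [DecidableEq A] [Fintype B] [DecidableEq B]
    [Fintype A'] [Fintype B'] [Fintype C] [Fintype C'] {ℰ : Superop A (A' × C)}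
    {𝒟 : Superop (C' × B) B'} (hℰ : IsQuantumChannel ℰ) (h𝒟 : IsQuantumChannel 𝒟) {n : ℕ}
    {P : Fin n → Matrix C C ℂ} {Q : Fin n → Matrix C' C' ℂ} (hP : ∀ y, (P y).PosSemidef)
    (hQ : ∀ y, IsDensityOperator (Q y))
    (htr : IsQuantumChannel (∑ y, measurePrepare (P y) (Q y))) :
    messageProtocol ℰ (∑ y, measurePrepare (P y) (Q y)) 𝒟 ∈ oneWayLOCC A B A' B' := by
  refine ⟨n, fun y => measureMessage ℰ (P y), fun y => 𝒟 ∘ₗ prepare (Q y) B,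
    fun y => isCompletelyPositive_measureMessage hℰ.1 (hP y), fun X => ?_,
    fun y => h𝒟.comp (isQuantumChannel_prepare (hQ y)), ?_⟩
  · have h : idTensor A' (∑ y, measurePrepare (P y) (Q y)) (ℰ X) =
        ∑ y, idTensor A' (measurePrepare (P y) (Q y)) (ℰ X) := by
      ext p q
      simp [idTensor_apply, Matrix.sum_apply]
    rw [LinearMap.sum_apply, Matrix.trace_sum,
      Finset.sum_congr rfl fun y _ => trace_measureMessage ℰ (P y) (hQ y).2 X,
      ← Matrix.trace_sum, ← h, htr.idTensor.2, hℰ.2]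
  · simp only [← messageProtocol_measurePrepare]
    exact map_sum (messageProtocolLinearMap ℰ 𝒟) _ _

theorem exists_mem_oneWayLOCC_diamondNorm_le [Fintype A] [DecidableEq A] [Fintype B]
    [DecidableEq B] [Fintype A'] [DecidableEq A'] [Fintype B'] [DecidableEq B'] [Fintype C]
    [Nonempty C] [Fintype C'] [DecidableEq C'] [Nonempty C'] {k : ℕ} {ℰ : Superop A (A' × C)}
    {𝒜 : Superop C C'} {𝒟 : Superop (C' × B) B'} (hℰ : IsQuantumChannel ℰ)
    (h𝒜 : IsKExtendibleMessage k 𝒜) (h𝒟 : IsQuantumChannel 𝒟) :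
    ∃ L ∈ oneWayLOCC A B A' B', diamondNorm (messageProtocol ℰ 𝒜 𝒟 - L) ≤
      2 * (Fintype.card C' : ℝ) ^ 2 / ((Fintype.card C' : ℝ) ^ 2 + k) := by
  classical
  obtain ⟨n, P, Q, hP, hQ, hPQ⟩ := h𝒜.exists_sum_measurePrepare
  set d : ℝ := (Fintype.card C' : ℝ) ^ 2 with hd
  have hd₀ : 0 < d := by
    have : 0 < Fintype.card C' := Fintype.card_pos
    positivity
  have hs : 0 < d + k := by positivity
  have hs' : ((d + k : ℝ) : ℂ) ≠ 0 := Complex.ofReal_ne_zero.2 hs.ne'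
  have hscale : ∑ y, measurePrepare ((d + k)⁻¹ • P y) (Q y) =
      (((d + k)⁻¹ : ℝ) : ℂ) • ∑ y, measurePrepare (P y) (Q y) := by
    rw [Finset.smul_sum]
    refine Finset.sum_congr rfl fun y _ => choi_injective ?_
    ext p q
    change choi (measurePrepare _ _) p q = _ * choi (measurePrepare _ _) p q
    rw [measurePrepare, measurePrepare, choi_ofChoi, choi_ofChoi, Matrix.kroneckerMap_apply,
      Matrix.kroneckerMap_apply, Matrix.smul_apply, Complex.real_smul, mul_assoc]
  have hdiff : 𝒜 - ∑ y, measurePrepare ((d + k)⁻¹ • P y) (Q y) =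
      ((d / (d + k) : ℝ) : ℂ) • (𝒜 - depolarizing C C') := by
    have hd' : (Fintype.card C' : ℂ) ^ 2 = (d : ℂ) := by
      rw [hd]
      push_cast
      rfl
    rw [hscale, hPQ, hd']
    refine choi_injective ?_
    ext p q
    change choi 𝒜 p q - _ * (_ * choi 𝒜 p q + _ * choi (depolarizing C C') p q) =
      _ * (choi 𝒜 p q - choi (depolarizing C C') p q)
    push_cast at hs' ⊢
    field_simp
    ring
  have hchannel : IsQuantumChannel (∑ y, measurePrepare ((d + k)⁻¹ • P y) (Q y)) := by
    refine ⟨isCompletelyPositive_sum _ fun y _ => isCompletelyPositive_measurePrepare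
      ((hP y).smul (inv_nonneg.2 hs.le)) (hQ y).1, fun X => ?_⟩
    -- Trace preservation is read off from `hdiff`, whose right side is a multiple of a difference
    -- of channels.
    have h := congrArg Matrix.trace (LinearMap.congr_fun hdiff X)
    rw [LinearMap.sub_apply, LinearMap.smul_apply, LinearMap.sub_apply, Matrix.trace_sub,
      Matrix.trace_smul, Matrix.trace_sub, (isQuantumChannel_depolarizing C C').2,
      h𝒜.isQuantumChannel.2, sub_self, smul_zero, sub_eq_zero] at h
    exact h.symm
  refine ⟨_, messageProtocol_mem_oneWayLOCC hℰ h𝒟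
    (fun y => (hP y).smul (inv_nonneg.2 hs.le)) hQ hchannel, ?_⟩
  have h : messageProtocol ℰ 𝒜 𝒟 -
      messageProtocol ℰ (∑ y, measurePrepare ((d + k)⁻¹ • P y) (Q y)) 𝒟 =
      ((d / (d + k) : ℝ) : ℂ) • (messageProtocol ℰ 𝒜 𝒟 -
        messageProtocol ℰ (depolarizing C C') 𝒟) := by
    change messageProtocolLinearMap ℰ 𝒟 _ - messageProtocolLinearMap ℰ 𝒟 _ =
      _ • (messageProtocolLinearMap ℰ 𝒟 _ - messageProtocolLinearMap ℰ 𝒟 _)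
    rw [← map_sub, hdiff, map_smul, map_sub]
  rw [h]
  refine (diamondNorm_smul_sub_le (hℰ.messageProtocol h𝒜.isQuantumChannel h𝒟)
    (hℰ.messageProtocol (isQuantumChannel_depolarizing C C') h𝒟) (by positivity)).trans_eq ?_
  rw [mul_div_assoc]

end MessageProtocol

/-! ### The theorem. -/

theorem mainTheorem8 {A B A' B' C C' : Type*}
    [Fintype A] [DecidableEq A] [Nonempty A] [Fintype B] [DecidableEq B] [Nonempty B]
    [Fintype A'] [DecidableEq A'] [Nonempty A'] [Fintype B'] [DecidableEq B'] [Nonempty B']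
    [Fintype C] [Nonempty C] [Fintype C'] [DecidableEq C'] [Nonempty C'] :
    (∀ (k : ℕ) (ℰ : Superop A (A' × C)) (𝒜 : Superop C C') (𝒟 : Superop (C' × B) B'),
      IsQuantumChannel ℰ → IsKExtendibleMessage k 𝒜 → IsQuantumChannel 𝒟 →
      ∃ L ∈ oneWayLOCC A B A' B',
        (∀ L' ∈ oneWayLOCC A B A' B',
          diamondNorm (messageProtocol ℰ 𝒜 𝒟 - L) ≤ diamondNorm (messageProtocol ℰ 𝒜 𝒟 - L')) ∧
        diamondNorm (messageProtocol ℰ 𝒜 𝒟 - L) ≤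
          (Fintype.card C : ℝ) *
            (2 * (Fintype.card C' : ℝ) ^ 2 / ((Fintype.card C' : ℝ) ^ 2 + k)) ∧
        (Fintype.card C' ≤ Fintype.card C →
          diamondNorm (messageProtocol ℰ 𝒜 𝒟 - L) ≤
            (Fintype.card C : ℝ) *
              (2 * (Fintype.card C : ℝ) ^ 2 / ((Fintype.card C : ℝ) ^ 2 + k)))) ∧
    (∀ ε : ℝ, 0 < ε → ∃ k₀ : ℕ, ∀ k ≥ k₀,
      ∀ (ℰ : Superop A (A' × C)) (𝒜 : Superop C C') (𝒟 : Superop (C' × B) B'),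
        IsQuantumChannel ℰ → IsKExtendibleMessage k 𝒜 → IsQuantumChannel 𝒟 →
        ∃ L ∈ oneWayLOCC A B A' B', diamondNorm (messageProtocol ℰ 𝒜 𝒟 - L) < ε) := by
  have hC : (1 : ℝ) ≤ Fintype.card C := by exact_mod_cast Fintype.card_pos (α := C)
  have hC' : (0 : ℝ) < Fintype.card C' := by exact_mod_cast Fintype.card_pos (α := C')
  refine ⟨fun k ℰ 𝒜 𝒟 hℰ h𝒜 h𝒟 => ?_, fun ε hε => ?_⟩
  · obtain ⟨L₀, hL₀, hbound⟩ := exists_mem_oneWayLOCC_diamondNorm_le hℰ h𝒜 h𝒟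
    obtain ⟨L, hL, hmin⟩ := exists_isMinOn_diamondNorm_sub
      (hℰ.messageProtocol h𝒜.isQuantumChannel h𝒟) ⟨L₀, hL₀⟩
    have hle : diamondNorm (messageProtocol ℰ 𝒜 𝒟 - L) ≤ (Fintype.card C : ℝ) *
        (2 * (Fintype.card C' : ℝ) ^ 2 / ((Fintype.card C' : ℝ) ^ 2 + k)) :=
      ((hmin L₀ hL₀).trans hbound).trans (le_mul_of_one_le_left (by positivity) hC)
    refine ⟨L, hL, hmin, hle, fun hcard => hle.trans ?_⟩
    have hcard' : (Fintype.card C' : ℝ) ^ 2 ≤ (Fintype.card C : ℝ) ^ 2 := by gcongr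
    gcongr ?_ * ?_
    -- The function `t ↦ 2t/(t + k)` is nondecreasing in `t = |C'|²`.
    rw [div_le_div_iff₀ (by positivity) (by positivity)]
    nlinarith [mul_le_mul_of_nonneg_right hcard' (Nat.cast_nonneg k : (0 : ℝ) ≤ k)]
  -- With `d = |C'|`, already `2d²/k < ε` suffices, since the bound is at most `2d²/k`; the
  -- threshold does not depend on the channels.
  · obtain ⟨k₀, hk₀⟩ := exists_nat_gt (2 * (Fintype.card C' : ℝ) ^ 2 / ε)
    refine ⟨k₀, fun k hk ℰ 𝒜 𝒟 hℰ h𝒜 h𝒟 => ?_⟩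
    obtain ⟨L, hL, hbound⟩ := exists_mem_oneWayLOCC_diamondNorm_le hℰ h𝒜 h𝒟
    refine ⟨L, hL, hbound.trans_lt ?_⟩
    have hk' : (k₀ : ℝ) ≤ k := Nat.cast_le.2 hk
    rw [div_lt_iff₀ hε] at hk₀
    rw [div_lt_iff₀ (by positivity)]
    nlinarith [sq_nonneg (Fintype.card C' : ℝ)]
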